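/- **Setting.** Let $\Omega\subset\mathbb R^d$, $\Sigma\subset\mathbb R$ and $\Theta\subset S^{d-1}$ be compact, let $\mathcal H_\Sigma$ and $\mathcal H_\Theta$ be Borel probability measures on $\Sigma$ and $\Theta$ with $\operatorname{supp}\mathcal H_\Theta=\Theta$, let $\hat\theta\in\Theta$, and let $\mathcal T\subset\Sigma$ be finite. $\mathcal M(X)$ and $\mathcal M_+(X)$ denote the finite signed, respectively nonnegative, Radon measures on $X$, $\|\cdot\|_{\mathcal M}$ the total variation norm, and $F_\#\nu$ the pushforward. Put $\Lambda=\{(x,v)\in\mathbb R^d\times\mathbb R^d: x+tv\in\Omega\ \forall t\in\Sigma\}$ and $\Gamma=\{(\theta\cdot x,\theta\cdot v):(x,v)\in\Lambda,\ \theta\in\Theta\}\subset\mathbb R^2$. Let $R_\theta\nu=[x\mapsto\theta\cdot x]_\#\nu$, $\mathrm{mv}^n_t\nu=[(x,v)\mapsto x+tv]_\#\nu$ for measures $\nu$ on (subsets of) $\mathbb R^n\times\mathbb R^n$, $R\nu=\mathcal H_\Theta(\theta)\otimes R_\theta\nu$ and $\mathrm{mv}\,\nu=\mathrm{mv}^1_t\nu\otimes\mathcal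 H_\Sigma(t)$, where for a probability measure $\mathcal H$ on $Z$ and a family $\nu_z\in\mathcal M_+(Y)$ with $z\mapsto\nu_z(A)$ $\mathcal H$-measurable for all Borel $A$, $\mathcal H(z)\otimes\nu_z$ is the measure with $(\mathcal H\otimes\nu_z)(B\times A)=\int_B\nu_z(A)\,d\mathcal H(z)$, and $\nu_z\otimes\mathcal H(z)$ is the same measure with the factors exchanged. Let $H$ be a Hilbert space and for $t\in\mathcal T$ let $\mathrm{Ob}_t:\mathcal M(\Omega)\to H$ be the dual of a bounded linear operator $H\to C(\Omega)$. For $f=(f_t)_{t\in\mathcal T}\in H^{|\mathcal T|}$ and $\alpha\ge0$ let $D(w)=\frac1{2\alpha}\sum_{t\in\mathcal T}\|\mathrm{Ob}_tw_t-f_t\|_H^2$ for $w\in\mathcal M_+(\Omega)^\Sigma$, where for $\alpha=0$ this means $D(w)=0$ if $\mathrm{Ob}_tw_t=f_t$ for all $t\in\mathcal T$, and $D(w)=\infty$ otherwise. Consider the following problems. * (P, product/product): minimize $\|\gamma_{\hat\theta}\|_{\mathcal M}+D(u)$ over $\gamma\in\mathcal M_+(\Gamma)^\Theta$, $u\in\mathcal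 M_+(\Omega)^\Sigma$ such that $\mathrm{mv}^1_t\gamma_\theta=R_\theta u_t$ for all $t\in\Sigma$, $\theta\in\Theta$. * (X, mixed): minimize $\|\gamma\|_{\mathcal M}+D(u)$ over $\gamma\in\mathcal M_+(\Theta\times\Gamma)$, $u\in\mathcal M_+(\Omega)^\Sigma$ such that $\gamma=\mathcal H_\Theta(\theta)\otimes\gamma_\theta$ for some family $(\gamma_\theta)$ and, for all $t\in\Sigma$, $\mathrm{mv}^1_t\gamma_\theta=R_\theta u_t$ for $\mathcal H_\Theta$-a.a. $\theta$. * (M, measure/measure): minimize $\|\gamma\|_{\mathcal M}+D((u_t)_{t\in\Sigma})$ over $\gamma\in\mathcal M_+(\Theta\times\Gamma)$, $u\in\mathcal M_+(\Omega\times\Sigma)$ such that $\gamma=\mathcal H_\Theta(\theta)\otimes\gamma_\theta$ and $u=\tilde u_t\otimes\mathcal H_\Sigma(t)$ for some families $(\gamma_\theta)$, $(\tilde u_t)$ with $\mathrm{mv}^1_t\gamma_\theta=R_\theta\tilde u_t$ for $\mathcal H_\Sigma$-a.a. $t$ and $\mathcal H_\Theta$-a.a. $\theta$; in the objective, $(u_t)_{t\in\Sigma}$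 are the slices of $u$ in the following sense. *Slices.* A family $(u_t)_{t\in\Sigma}$ in $\mathcal M_+(\Omega)$ is called a family of slices of $u\in\mathcal M_+(\Omega\times\Sigma)$ if $u=u_t\otimes\mathcal H_\Sigma(t)$ and $t\mapsto Ru_t$ is weakly-$*$ continuous on $\Sigma$. A family $(\gamma_\theta)_{\theta\in\Theta}$ in $\mathcal M_+(\Gamma)$ is called a family of slices of $\gamma\in\mathcal M_+(\Theta\times\Gamma)$ if $\gamma=\mathcal H_\Theta(\theta)\otimes\gamma_\theta$ and $\theta\mapsto\mathrm{mv}\,\gamma_\theta$ is weakly-$*$ continuous on $\Theta$. A measure on a product and a family of measures *coincide* if the family is the one and only family of slices of the measure. **Theorem.** Let $f\in H^{|\mathcal T|}$ and $\alpha\ge0$; if $\alpha=0$, assume that there is $\lambda\in\mathcal M_+(\mathbb R^d\times\mathbb R^d)$ with $\mathrm{mv}^d_t\lambda\in\mathcal M_+(\Omega)$ for all $t\in\Sigma$ and $\mathrm{Ob}_t\mathrm{mv}^d_t\lambda=f_t$ for all $t\in\mathcal T$. Call the Radon transform injective if $\nu\mapsto(R_\theta\nu)_{\theta\in\operatorname{supp}\mathcal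 H_\Theta}$ is injective on $\mathcal M(\Omega)$, and the move operator injective if $\nu\mapsto(\mathrm{mv}^1_t\nu)_{t\in\operatorname{supp}\mathcal H_\Sigma}$ is injective on $\mathcal M(\Gamma)$. 1. If $\operatorname{supp}\mathcal H_\Sigma=\Sigma$ and the Radon transform is injective, then for every pair $(\gamma,u)$ admissible in (M) there is exactly one family of slices $(u_t)_{t\in\Sigma}$ of $u$, so that the objective of (M) is well-defined. 2. (P) and (X) admit minimizers (with finite objective), and so does (M) if $\operatorname{supp}\mathcal H_\Sigma=\Sigma$ and the Radon transform is injective. 3. (a) If the move operator is injective, then (P) and (X) are equivalent: for every minimizer $(\gamma,u)$ of (X) there is exactly one $\tilde\gamma\in\mathcal M_+(\Gamma)^\Theta$ coinciding with $\gamma$ such that $(\tilde\gamma,u)$ is a minimizer of (P) with the same objective value, and for every minimizer $(\tilde\gamma,u)$ of (P) there is exactly one $\gamma\in\mathcal M_+(\Theta\times\Gamma)$ coinciding with $\tilde\gamma$ such that $(\gamma,u)$ is a minimizer of (X) with the same objective value. (b) If $\operatorname{supp}\mathcal H_\Sigma=\Sigma$ and the Radon transform is injective, then (X) and (M) are equivalent: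 for every minimizer $(\gamma,\tilde u)$ of (X) there is exactly one $u\in\mathcal M_+(\Omega\times\Sigma)$ coinciding with $\tilde u$ such that $(\gamma,u)$ is a minimizer of (M) with the same objective value, and for every minimizer $(\gamma,u)$ of (M) there is exactly one $\tilde u\in\mathcal M_+(\Omega)^\Sigma$ coinciding with $u$ such that $(\gamma,\tilde u)$ is a minimizer of (X) with the same objective value. -/

import Mathlib

open MeasureTheory
open scoped ENNReal

/-! Nonnegative finite Radon measures on a space `X` are elements of `FiniteMeasure X`, with the
topology of weak (narrow) convergence, signed ones are elements of `SignedMeasure X`: on the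
`σ`-compact metric spaces below every finite Borel measure is regular.
`Ω` is the spatial domain, `S` the time domain, `Θ` the set of directions. -/

/-- The lifted position-velocity domain: no particle leaves `Ω` at any time in `S`. -/
def phaseDomain {d : ℕ} (Ω : Set (EuclideanSpace ℝ (Fin d))) (S : Set ℝ) :
    Set (EuclideanSpace ℝ (Fin d) × EuclideanSpace ℝ (Fin d)) :=
  {p | ∀ t ∈ S, p.1 + t • p.2 ∈ Ω}

/-- The set of one-dimensional projected positions and velocities. -/
def projDomain {d : ℕ} (Ω : Set (EuclideanSpace ℝ (Fin d))) (S : Set ℝ)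
    (Θ : Set (EuclideanSpace ℝ (Fin d))) : Set (ℝ × ℝ) :=
  {z | ∃ θ ∈ Θ, ∃ p ∈ phaseDomain Ω S, z = (inner ℝ θ p.1, inner ℝ θ p.2)}

section Operators

variable {d : ℕ} {Ω : Set (EuclideanSpace ℝ (Fin d))} {S : Set ℝ}
  {Θ : Set (EuclideanSpace ℝ (Fin d))} {G : Set (ℝ × ℝ)}

/-- The Radon transform in direction `θ`: pushforward under `x ↦ θ · x`. -/
noncomputable def radonAt (θ : EuclideanSpace ℝ (Fin d)) (u : FiniteMeasure Ω) : FiniteMeasure ℝ :=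
  u.map (fun x : Ω => (inner ℝ θ (x : EuclideanSpace ℝ (Fin d)) : ℝ))

/-- The one-dimensional move operator at time `t`: pushforward under `(x, v) ↦ x + t v`. -/
noncomputable def moveAt (t : ℝ) (g : FiniteMeasure G) : FiniteMeasure ℝ :=
  g.map (fun z : G => (z : ℝ × ℝ).1 + t * (z : ℝ × ℝ).2)

/-- The Radon transform `u ↦ HΘ(θ) ⊗ radonAt θ u`, a measure on `Θ × ℝ`, written as the pushforward
of the product measure `HΘ ⊗ u` under `(θ, x) ↦ (θ, θ · x)`. -/
noncomputable def radon (HΘ : ProbabilityMeasure Θ) (u : FiniteMeasure Ω) :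
    FiniteMeasure (Θ × ℝ) :=
  (HΘ.toFiniteMeasure.prod u).map (fun p : Θ × Ω =>
    (p.1, (inner ℝ (p.1 : EuclideanSpace ℝ (Fin d)) (p.2 : EuclideanSpace ℝ (Fin d)) : ℝ)))

/-- The move operator `g ↦ moveAt t g ⊗ HS(t)`, a measure on `ℝ × S`, written as the pushforward of
the product measure `g ⊗ HS` under `((x, v), t) ↦ (x + t v, t)`. -/
noncomputable def move (HS : ProbabilityMeasure S) (g : FiniteMeasure G) : FiniteMeasure (ℝ × S) :=
  (g.prod HS.toFiniteMeasure).map (fun p : G × S =>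
    ((p.1 : ℝ × ℝ).1 + (p.2 : ℝ) * (p.1 : ℝ × ℝ).2, p.2))

/-- Injectivity on signed measures on `Ω` of the family of Radon transforms over `supp HΘ`. -/
def RadonInjective (Ω : Set (EuclideanSpace ℝ (Fin d))) (HΘ : ProbabilityMeasure Θ) : Prop :=
  Function.Injective (fun (ν : SignedMeasure Ω) (θ : (HΘ : Measure Θ).support) =>
    ν.map (fun x : Ω => (inner ℝ ((θ : Θ) : EuclideanSpace ℝ (Fin d))
      (x : EuclideanSpace ℝ (Fin d)) : ℝ)))

/-- Injectivity on signed measures on `G` of the family of move operators over `supp HS`. -/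
def MoveInjective (G : Set (ℝ × ℝ)) (HS : ProbabilityMeasure S) : Prop :=
  Function.Injective (fun (ν : SignedMeasure G) (t : (HS : Measure S).support) =>
    ν.map (fun z : G => (z : ℝ × ℝ).1 + ((t : S) : ℝ) * (z : ℝ × ℝ).2))

end Operators

section Slices

/-- `γ = H(z) ⊗ g z` as measures on `Z × Y`. -/
def IsLeftProduct {Z Y : Type*} [MeasurableSpace Z] [MeasurableSpace Y] (H : ProbabilityMeasure Z)
    (g : Z → FiniteMeasure Y) (γ : FiniteMeasure (Z × Y)) : Prop :=
  (∀ A : Set Y, MeasurableSet A → AEMeasurable (fun z => (g z : Measure Y) A) (H : Measure Z)) ∧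
  ∀ (B : Set Z) (A : Set Y), MeasurableSet B → MeasurableSet A →
    (γ : Measure (Z × Y)) (B ×ˢ A) = ∫⁻ z in B, (g z : Measure Y) A ∂(H : Measure Z)

/-- `u = v z ⊗ H(z)` as measures on `Y × Z`. -/
def IsRightProduct {Y Z : Type*} [MeasurableSpace Y] [MeasurableSpace Z]
    (v : Z → FiniteMeasure Y) (H : ProbabilityMeasure Z) (u : FiniteMeasure (Y × Z)) : Prop :=
  (∀ A : Set Y, MeasurableSet A → AEMeasurable (fun z => (v z : Measure Y) A) (H : Measure Z)) ∧
  ∀ (A : Set Y) (B : Set Z), MeasurableSet A → MeasurableSet B →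
    (u : Measure (Y × Z)) (A ×ˢ B) = ∫⁻ z in B, (v z : Measure Y) A ∂(H : Measure Z)

variable {d : ℕ} {Ω : Set (EuclideanSpace ℝ (Fin d))} {S : Set ℝ}
  {Θ : Set (EuclideanSpace ℝ (Fin d))} {G : Set (ℝ × ℝ)}

/-- `v` is a family of time slices of `u`, defined at every time: `u = v t ⊗ HS(t)`, and the Radon
transforms of the slices depend (weakly-*) continuously on time. -/
def IsTimeSlices (HS : ProbabilityMeasure S) (HΘ : ProbabilityMeasure Θ)
    (u : FiniteMeasure (Ω × S)) (v : S → FiniteMeasure Ω) : Prop :=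
  IsRightProduct v HS u ∧ Continuous (fun t : S => radon HΘ (v t))

/-- `g` is a family of direction slices of `γ`, defined in every direction: `γ = HΘ(θ) ⊗ g θ`, and
the moved slices depend (weakly-*) continuously on the direction. -/
def IsDirectionSlices (HS : ProbabilityMeasure S) (HΘ : ProbabilityMeasure Θ)
    (γ : FiniteMeasure (Θ × G)) (g : Θ → FiniteMeasure G) : Prop :=
  IsLeftProduct HΘ g γ ∧ Continuous (fun θ : Θ => move HS (g θ))

/-- `u` and the family `v` coincide: the time slices of `u` are uniquely defined and equal `v`. -/
def SnapshotsCoincide (HS : ProbabilityMeasure S) (HΘ : ProbabilityMeasure Θ)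
    (u : FiniteMeasure (Ω × S)) (v : S → FiniteMeasure Ω) : Prop :=
  IsTimeSlices HS HΘ u v ∧ ∀ v', IsTimeSlices HS HΘ u v' → v' = v

/-- `γ` and the family `g` coincide: the direction slices of `γ` are uniquely defined and
equal `g`. -/
def ProjectionsCoincide (HS : ProbabilityMeasure S) (HΘ : ProbabilityMeasure Θ)
    (γ : FiniteMeasure (Θ × G)) (g : Θ → FiniteMeasure G) : Prop :=
  IsDirectionSlices HS HΘ γ g ∧ ∀ g', IsDirectionSlices HS HΘ γ g' → g' = g

open Classical in
/-- The time slices of `u`. The value `0` is used only if `u` has no time slices. -/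
noncomputable def timeSlices (HS : ProbabilityMeasure S) (HΘ : ProbabilityMeasure Θ)
    (u : FiniteMeasure (Ω × S)) : S → FiniteMeasure Ω :=
  if h : ∃ v, IsTimeSlices HS HΘ u v then h.choose else 0

end Slices

section Models

variable {d : ℕ} {Ω : Set (EuclideanSpace ℝ (Fin d))} {S : Set ℝ}
  {Θ : Set (EuclideanSpace ℝ (Fin d))} {G : Set (ℝ × ℝ)}
  {H : Type*} [NormedAddCommGroup H] [InnerProductSpace ℝ H]

/-- Observation operators: (the restriction to nonnegative measures of) the dual of a bounded linear
operator from `H` to `C(Ω)`. -/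
def IsObservationOperator (Ob : FiniteMeasure Ω → H) : Prop :=
  ∃ A : H →L[ℝ] C(Ω, ℝ), ∀ (u : FiniteMeasure Ω) (h : H),
    inner ℝ (Ob u) h = ∫ x, A h x ∂(u : Measure Ω)

open Classical in
/-- The fidelity term; for `α = 0` it is the hard constraint `Ob t (v t) = f t` for all `t`. -/
noncomputable def fidelity {T : Finset S} (Ob : T → FiniteMeasure Ω → H) (f : T → H) (α : ℝ)
    (v : S → FiniteMeasure Ω) : ℝ≥0∞ :=
  if α = 0 then (if ∀ t : T, Ob t (v t) = f t then 0 else ⊤)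
  else ENNReal.ofReal (1 / (2 * α) * ∑ t : T, ‖Ob t (v t) - f t‖ ^ 2)

/-- The constraint of the product/product model. -/
def ProductAdmissible (p : (Θ → FiniteMeasure G) × (S → FiniteMeasure Ω)) : Prop :=
  ∀ (t : S) (θ : Θ), moveAt (t : ℝ) (p.1 θ) = radonAt (θ : EuclideanSpace ℝ (Fin d)) (p.2 t)

/-- The constraint of the mixed model. -/
def MixedAdmissible (HΘ : ProbabilityMeasure Θ)
    (p : FiniteMeasure (Θ × G) × (S → FiniteMeasure Ω)) : Prop :=
  ∃ g : Θ → FiniteMeasure G, IsLeftProduct HΘ g p.1 ∧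
    ∀ t : S, ∀ᵐ (θ : Θ) ∂(HΘ : Measure Θ),
      moveAt (t : ℝ) (g θ) = radonAt (θ : EuclideanSpace ℝ (Fin d)) (p.2 t)

/-- The constraint of the measure/measure model. -/
def MeasureAdmissible (HS : ProbabilityMeasure S) (HΘ : ProbabilityMeasure Θ)
    (p : FiniteMeasure (Θ × G) × FiniteMeasure (Ω × S)) : Prop :=
  ∃ (g : Θ → FiniteMeasure G) (v : S → FiniteMeasure Ω),
    IsLeftProduct HΘ g p.1 ∧ IsRightProduct v HS p.2 ∧
    ∀ᵐ (t : S) ∂(HS : Measure S), ∀ᵐ (θ : Θ) ∂(HΘ : Measure Θ),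
      moveAt (t : ℝ) (g θ) = radonAt (θ : EuclideanSpace ℝ (Fin d)) (v t)

/-- The objective of the product/product model, with the fixed direction `θ₀`. -/
noncomputable def productEnergy {T : Finset S} (θ₀ : Θ) (Ob : T → FiniteMeasure Ω → H) (f : T → H)
    (α : ℝ) (p : (Θ → FiniteMeasure G) × (S → FiniteMeasure Ω)) : ℝ≥0∞ :=
  (p.1 θ₀).mass + fidelity Ob f α p.2

/-- The objective of the mixed model. -/
noncomputable def mixedEnergy {T : Finset S} (Ob : T → FiniteMeasure Ω → H) (f : T → H) (α : ℝ)
    (p : FiniteMeasure (Θ × G) × (S → FiniteMeasure Ω)) : ℝ≥0∞ :=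
  p.1.mass + fidelity Ob f α p.2

/-- The objective of the measure/measure model. -/
noncomputable def measureEnergy {T : Finset S} (HS : ProbabilityMeasure S)
    (HΘ : ProbabilityMeasure Θ) (Ob : T → FiniteMeasure Ω → H) (f : T → H) (α : ℝ)
    (p : FiniteMeasure (Θ × G) × FiniteMeasure (Ω × S)) : ℝ≥0∞ :=
  p.1.mass + fidelity Ob f α (timeSlices HS HΘ p.2)

/-- `x` solves the minimization of `E` over the set `Adm`. -/
def IsSolution {X : Type*} (Adm : X → Prop) (E : X → ℝ≥0∞) (x : X) : Prop :=
  Adm x ∧ E x < ⊤ ∧ ∀ y, Adm y → E x ≤ E y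

/-- For the data `f` there is a compatible configuration: a measure `l` on positions and velocities
whose snapshots at all times of `S` are measures on `Ω`, with observations `f`. -/
def CompatibleData {T : Finset S} (Ob : T → FiniteMeasure Ω → H) (f : T → H) : Prop :=
  ∃ (l : FiniteMeasure (EuclideanSpace ℝ (Fin d) × EuclideanSpace ℝ (Fin d)))
    (w : S → FiniteMeasure Ω),
    (∀ t : S, (w t).map (fun x : Ω => (x : EuclideanSpace ℝ (Fin d))) =
      l.map (fun p => p.1 + (t : ℝ) • p.2)) ∧
    ∀ t : T, Ob t (w t) = f t

end Models

/-! The mixed model is the pivot: each of the other two is compared with it, and minimizers are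
transported along energy-preserving maps between admissible sets (`IsSolution.transfer`).

For a measure `γ` that disintegrates over the directions, the almost-everywhere constraint at time
`t` is the single identity `moveDirections t γ = radon HΘ (u t)` between measures on `Θ × ℝ`
(`ae_moveAt_eq_radonAt_iff`). Both sides are weakly continuous in the measures and the left one also
in `t`. Moreover every operator preserves mass, so `γ`, all its direction slices and all snapshots
have the same mass. Hence energies agree across the models, and a bound on the energy bounds every
component.

Almost-everywhere constraints become everywhere constraints by compactness. On a compact space the
measures of mass at most `C` form a weakly compact set, so their image under a continuous operator
is closed. If a continuous curve lies in that image for almost every parameter and the parameter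
measure has full support, it lies there for every parameter. Applied in time, this gives snapshots
at all times in the measure/measure model. Applied in direction, it gives projections in all
directions in the mixed model, where countable dense sets of times avoid the dependence of the null
sets on time. Injectivity makes the resulting slices unique and identifies them with the given ones
almost everywhere. Conversely, a continuous injection on a compact set is an embedding, so families
with continuous images are themselves continuous, hence measurable, and can be integrated to a
product measure.

Minimizers of the product/product and mixed models come from the direct method with Tychonoff
compactness; those of the measure/measure model are carried over from the mixed one. The projected
phase space is compact if there are two distinct times. With a single time compactness can fail, but
then the constraint only fixes the mass of `γ`, and one minimizes over the snapshot alone. -/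

/-! ### Product measures and their disintegrations -/

section ProductLemmas

variable {Z Y W : Type*} [MeasurableSpace Z] [MeasurableSpace Y] [MeasurableSpace W]
  {H : ProbabilityMeasure Z} {g g' : Z → FiniteMeasure Y} {γ γ' : FiniteMeasure (Z × Y)}

/-- A left product evaluates measurable sets by integrating the measures of their fibres. -/
theorem IsLeftProduct.apply (h : IsLeftProduct H g γ) {E : Set (Z × Y)} (hE : MeasurableSet E) :
    AEMeasurable (fun z => (g z : Measure Y) (Prod.mk z ⁻¹' E)) (H : Measure Z) ∧
      (γ : Measure (Z × Y)) E = ∫⁻ z, (g z : Measure Y) (Prod.mk z ⁻¹' E) ∂(H : Measure Z) := by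
  induction E, hE using MeasurableSpace.induction_on_inter generateFrom_prod.symm isPiSystem_prod with
  | empty => simp
  | basic E hE =>
    obtain ⟨B, hB, A, hA, rfl⟩ := hE
    have hB : MeasurableSet B := hB
    have hA : MeasurableSet A := hA
    have : (fun z => (g z : Measure Y) (Prod.mk z ⁻¹' B ×ˢ A)) =
        B.indicator (fun z => (g z : Measure Y) A) := by
      classical
      ext z
      rw [Set.mk_preimage_prod_right_eq_if, Set.indicator_apply]
      split_ifs <;> simp
    rw [this, h.2 B A hB hA, lintegral_indicator hB]
    exact ⟨(h.1 A hA).indicator hB, rfl⟩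
  | compl E hE ih =>
    -- Complements are handled by subtraction, which is legitimate because all measures involved are
    -- finite.
    have hfib : ∀ z, MeasurableSet (Prod.mk z ⁻¹' E) := fun z => measurable_prodMk_left hE
    have hsub : (fun z => (g z : Measure Y) (Prod.mk z ⁻¹' Eᶜ)) =
        fun z => (g z : Measure Y) Set.univ - (g z : Measure Y) (Prod.mk z ⁻¹' E) := by
      ext z
      rw [Set.preimage_compl, measure_compl (hfib z) (measure_ne_top _ _)]
    have huniv := h.1 Set.univ .univ
    have hmass := h.2 Set.univ Set.univ .univ .univ
    rw [Set.univ_prod_univ, Measure.restrict_univ] at hmass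
    rw [hsub]
    refine ⟨huniv.sub ih.1, ?_⟩
    rw [lintegral_sub' ih.1, ← hmass, ← ih.2, measure_compl hE (measure_ne_top _ _)]
    · rw [← ih.2]
      exact measure_ne_top _ _
    · exact .of_forall fun z => measure_mono (Set.subset_univ _)
  | iUnion f hd hf ih =>
    have hsum : (fun z => (g z : Measure Y) (Prod.mk z ⁻¹' ⋃ i, f i)) =
        fun z => ∑' i, (g z : Measure Y) (Prod.mk z ⁻¹' f i) := by
      ext z
      rw [Set.preimage_iUnion, measure_iUnion (fun i j hij => (hd hij).preimage _)
        fun i => measurable_prodMk_left (hf i)]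
    rw [hsum]
    refine ⟨AEMeasurable.tsum fun i => (ih i).1, ?_⟩
    rw [lintegral_tsum fun i => (ih i).1, measure_iUnion hd hf]
    exact tsum_congr fun i => (ih i).2

/-- Fibrewise pushforward of a left product. -/
theorem IsLeftProduct.map (h : IsLeftProduct H g γ) {φ : Z × Y → W} (hφ : Measurable φ) :
    IsLeftProduct H (fun z => (g z).map (fun y => φ (z, y))) (γ.map (fun p => (p.1, φ p))) := by
  have key : ∀ z (A : Set W), MeasurableSet A →
      (((g z).map (fun y => φ (z, y)) : FiniteMeasure W) : Measure W) A =
        (g z : Measure Y) (Prod.mk z ⁻¹' (φ ⁻¹' A)) := fun z A hA => by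
    rw [FiniteMeasure.toMeasure_map, Measure.map_apply (f := fun y => φ (z, y)) (hφ.comp measurable_prodMk_left) hA]
    rfl
  constructor
  · intro A hA
    simp_rw [key _ A hA]
    exact (h.apply (hφ hA)).1
  · intro B A hB hA
    simp_rw [key _ A hA]
    rw [FiniteMeasure.toMeasure_map,
      Measure.map_apply (measurable_fst.prodMk hφ) (hB.prod hA)]
    have hE : MeasurableSet ((Prod.fst ⁻¹' B ∩ φ ⁻¹' A : Set (Z × Y))) :=
      (measurable_fst hB).inter (hφ hA)
    have : (fun p : Z × Y => (p.1, φ p)) ⁻¹' (B ×ˢ A) = Prod.fst ⁻¹' B ∩ φ ⁻¹' A := rfl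
    rw [this, (h.apply hE).2, ← lintegral_indicator hB]
    refine lintegral_congr fun z => ?_
    classical
    rw [Set.indicator_apply]
    split_ifs with hz
    · congr 1
      ext y
      simp [hz]
    · rw [show Prod.mk z ⁻¹' (Prod.fst ⁻¹' B ∩ φ ⁻¹' A) = (∅ : Set Y) by ext y; simp [hz]]
      simp

theorem IsLeftProduct.unique (h : IsLeftProduct H g γ) (h' : IsLeftProduct H g γ') : γ = γ' := by
  refine FiniteMeasure.eq_of_forall_toMeasure_apply_eq _ _ fun E hE => ?_
  rw [(h.apply hE).2, (h'.apply hE).2]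

theorem IsLeftProduct.congr (h : IsLeftProduct H g γ) (hg : g =ᵐ[(H : Measure Z)] g') :
    IsLeftProduct H g' γ := by
  have hA : ∀ A : Set Y, (fun z => (g z : Measure Y) A) =ᵐ[(H : Measure Z)]
      fun z => (g' z : Measure Y) A := fun A => hg.mono fun z hz => by simp [hz]
  refine ⟨fun A hA' => (h.1 A hA').congr (hA A), fun B A hB hA' => ?_⟩
  rw [h.2 B A hB hA']
  exact lintegral_congr_ae (ae_restrict_of_ae (hA A))

/-- For each fixed set the two densities agree off a null set depending on that set. A countable
generating algebra yields one common null set, off which the measures agree by a π-system argument.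
-/
theorem IsLeftProduct.ae_eq [MeasurableSpace.CountablyGenerated Y] (h : IsLeftProduct H g γ)
    (h' : IsLeftProduct H g' γ) : g =ᵐ[(H : Measure Z)] g' := by
  let C : Set (Set Y) := generateSetAlgebra (MeasurableSpace.countableGeneratingSet Y)
  have hC : C.Countable :=
    countable_generateSetAlgebra (MeasurableSpace.countable_countableGeneratingSet)
  have hgen : MeasurableSpace.generateFrom C = ‹MeasurableSpace Y› := by
    rw [generateFrom_generateSetAlgebra_eq,
      MeasurableSpace.generateFrom_countableGeneratingSet]
  have halg : IsSetAlgebra C := isSetAlgebra_generateSetAlgebra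
  have hmeas : ∀ A ∈ C, MeasurableSet A := fun A hA =>
    hgen ▸ MeasurableSpace.measurableSet_generateFrom hA
  have hae : ∀ A ∈ C, ∀ᵐ z ∂(H : Measure Z), (g z : Measure Y) A = (g' z : Measure Y) A := by
    intro A hA
    refine AEMeasurable.ae_eq_of_forall_setLIntegral_eq (h.1 A (hmeas A hA)) (h'.1 A (hmeas A hA))
      ?_ ?_ fun B hB _ => ?_
    · have := h.2 Set.univ A .univ (hmeas A hA)
      rw [Measure.restrict_univ] at this
      rw [← this]
      exact measure_ne_top _ _
    · have := h'.2 Set.univ A .univ (hmeas A hA)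
      rw [Measure.restrict_univ] at this
      rw [← this]
      exact measure_ne_top _ _
    · rw [← h.2 B A hB (hmeas A hA), ← h'.2 B A hB (hmeas A hA)]
  filter_upwards [(ae_ball_iff hC).2 hae] with z hz
  have : IsFiniteMeasure (g z : Measure Y) := (g z).isFiniteMeasure
  refine FiniteMeasure.toMeasure_injective (ext_of_generate_finite C hgen.symm
    (fun s hs t ht _ => halg.inter_mem hs ht) hz (hz _ halg.univ_mem))

theorem isLeftProduct_prod (H : ProbabilityMeasure Z) (ν : FiniteMeasure Y) :
    IsLeftProduct H (fun _ => ν) (H.toFiniteMeasure.prod ν) := by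
  refine ⟨fun A _ => aemeasurable_const, fun B A _ _ => ?_⟩
  rw [FiniteMeasure.toMeasure_prod, Measure.prod_prod, lintegral_const, mul_comm]
  simp

/-- A measurable family of finite measures with bounded masses has a product measure. -/
theorem exists_isLeftProduct (H : ProbabilityMeasure Z)
    (hg : ∀ A : Set Y, MeasurableSet A → Measurable (fun z => (g z : Measure Y) A))
    {C : NNReal} (hC : ∀ z, (g z).mass ≤ C) : ∃ γ, IsLeftProduct H g γ := by
  let κ : ProbabilityTheory.Kernel Z Y :=
    ⟨fun z => (g z : Measure Y), Measure.measurable_of_measurable_coe _ hg⟩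
  have : ProbabilityTheory.IsFiniteKernel κ :=
    ⟨C, ENNReal.coe_lt_top, fun z => by
      change (g z : Measure Y) Set.univ ≤ C
      rw [← FiniteMeasure.ennreal_mass]
      exact_mod_cast hC z⟩
  refine ⟨⟨(H : Measure Z).compProd κ, inferInstance⟩, fun A hA => (hg A hA).aemeasurable,
    fun B A hB hA => ?_⟩
  exact Measure.compProd_apply_prod hB hA

/-- Disintegration of a finite measure whose first marginal is a multiple of `H`. -/
theorem exists_isLeftProduct_of_fst [StandardBorelSpace Y] (c : NNReal)
    (hγ : γ.map Prod.fst = c • H.toFiniteMeasure) : ∃ g, IsLeftProduct H g γ := by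
  have hm : (γ : Measure (Z × Y)).fst = c • (H : Measure Z) := congrArg Subtype.val hγ
  -- The conditional kernel exists only for a nonempty fibre; over an empty one every measure
  -- vanishes.
  rcases isEmpty_or_nonempty Y with hY | hY
  · refine ⟨0, fun A _ => aemeasurable_const, fun B A _ _ => ?_⟩
    rw [Set.eq_empty_of_isEmpty (B ×ˢ A)]
    simp
  · let κ := (γ : Measure (Z × Y)).condKernel
    refine ⟨fun z => c • ⟨κ z, inferInstance⟩, fun A hA => ?_, fun B A hB hA => ?_⟩
    · exact ((κ.measurable_coe hA).const_mul (c : ℝ≥0∞)).aemeasurable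
    · have h1 := Measure.compProd_apply_prod (μ := (γ : Measure (Z × Y)).fst) (κ := κ) hB hA
      rw [(γ : Measure (Z × Y)).disintegrate κ] at h1
      rw [h1, hm]
      have : (c • (H : Measure Z)).restrict B = (c : ℝ≥0∞) • (H : Measure Z).restrict B := by
        rw [Measure.restrict_smul]; rfl
      rw [this, lintegral_smul_measure, smul_eq_mul, ← lintegral_const_mul _ (κ.measurable_coe hA)]
      rfl

/-- Transfers all results on left products to right products. -/
theorem isRightProduct_iff_swap {u : FiniteMeasure (Y × Z)} :
    IsRightProduct g H u ↔ IsLeftProduct H g (u.map Prod.swap) := by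
  have : ∀ (A : Set Y) (B : Set Z), MeasurableSet A → MeasurableSet B →
      ((u.map Prod.swap : FiniteMeasure (Z × Y)) : Measure (Z × Y)) (B ×ˢ A) =
        (u : Measure (Y × Z)) (A ×ˢ B) := fun A B hA hB => by
    rw [FiniteMeasure.toMeasure_map, Measure.map_apply measurable_swap (hB.prod hA),
      Set.preimage_swap_prod]
  refine and_congr_right fun _ => ⟨fun h B A hB hA => ?_, fun h A B hA hB => ?_⟩
  · rw [this A B hA hB, h A B hA hB]
  · rw [← this A B hA hB, h B A hB hA]

theorem MeasureTheory.FiniteMeasure.map_swap_swap (u : FiniteMeasure (Y × Z)) :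
    (u.map Prod.swap).map Prod.swap = u := by
  refine Subtype.ext ?_
  change ((u : Measure (Y × Z)).map Prod.swap).map Prod.swap = (u : Measure (Y × Z))
  rw [Measure.map_map measurable_swap measurable_swap, Prod.swap_swap_eq, Measure.map_id]

theorem IsRightProduct.unique {u u' : FiniteMeasure (Y × Z)} (h : IsRightProduct g H u)
    (h' : IsRightProduct g H u') : u = u' := by
  rw [← FiniteMeasure.map_swap_swap u, ← FiniteMeasure.map_swap_swap u',
    (isRightProduct_iff_swap.1 h).unique (isRightProduct_iff_swap.1 h')]

theorem IsRightProduct.congr {u : FiniteMeasure (Y × Z)} (h : IsRightProduct g H u)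
    (hg : g =ᵐ[(H : Measure Z)] g') : IsRightProduct g' H u :=
  isRightProduct_iff_swap.2 ((isRightProduct_iff_swap.1 h).congr hg)

theorem IsRightProduct.ae_eq [MeasurableSpace.CountablyGenerated Y] {u : FiniteMeasure (Y × Z)}
    (h : IsRightProduct g H u) (h' : IsRightProduct g' H u) : g =ᵐ[(H : Measure Z)] g' :=
  (isRightProduct_iff_swap.1 h).ae_eq (isRightProduct_iff_swap.1 h')

theorem exists_isRightProduct (H : ProbabilityMeasure Z)
    (hg : ∀ A : Set Y, MeasurableSet A → Measurable (fun z => (g z : Measure Y) A))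
    {C : NNReal} (hC : ∀ z, (g z).mass ≤ C) : ∃ u, IsRightProduct g H u := by
  obtain ⟨γ, hγ⟩ := exists_isLeftProduct H hg hC
  refine ⟨γ.map Prod.swap, isRightProduct_iff_swap.2 ?_⟩
  rwa [FiniteMeasure.map_swap_swap]

theorem IsLeftProduct.mass_eq (h : IsLeftProduct H g γ) {c : NNReal}
    (hc : ∀ᵐ z ∂(H : Measure Z), (g z).mass = c) : γ.mass = c := by
  have := h.2 Set.univ Set.univ .univ .univ
  rw [Set.univ_prod_univ, Measure.restrict_univ, lintegral_congr_ae (g := fun _ => (c : ℝ≥0∞))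
    (hc.mono fun z hz => by simp only; rw [← FiniteMeasure.ennreal_mass, hz])] at this
  simp only [lintegral_const, measure_univ, mul_one] at this
  rw [← FiniteMeasure.ennreal_mass] at this
  exact_mod_cast this

theorem MeasureTheory.FiniteMeasure.mass_map {f : Y → W} (hf : Measurable f) (ν : FiniteMeasure Y) :
    (ν.map f).mass = ν.mass := by
  rw [FiniteMeasure.mass, FiniteMeasure.mass, ν.map_apply hf .univ, Set.preimage_univ]

end ProductLemmas

/-! ### Weak continuity and measurability of families of measures -/

section WeakContinuity

variable {P Y W : Type*} [TopologicalSpace P] [TopologicalSpace Y] [MeasurableSpace Y]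
  [OpensMeasurableSpace Y] [TopologicalSpace W] [MeasurableSpace W] [BorelSpace W]

/-- Pushforwards depend weakly continuously on the map. -/
theorem MeasureTheory.FiniteMeasure.continuous_map_of_continuous [FirstCountableTopology P] (ν : FiniteMeasure Y) {φ : P → Y → W}
    (h₁ : ∀ y, Continuous fun p => φ p y) (h₂ : ∀ p, Continuous (φ p)) :
    Continuous fun p => ν.map (φ p) := by
  rw [FiniteMeasure.continuous_iff_forall_continuous_lintegral]
  intro f
  have : ∀ p, ∫⁻ w, f w ∂(ν.map (φ p) : Measure W) = ∫⁻ y, f (φ p y) ∂(ν : Measure Y) := fun p => by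
    rw [FiniteMeasure.toMeasure_map, lintegral_map _ (h₂ p).measurable]
    exact (ENNReal.continuous_coe.comp f.continuous).measurable
  simp_rw [this]
  refine continuous_iff_continuousAt.2 fun p => tendsto_lintegral_filter_of_dominated_convergence
    (fun _ => (nndist f 0 : ℝ≥0∞)) (.of_forall fun q => ?_) (.of_forall fun q => .of_forall fun y => ?_) ?_
    (.of_forall fun y => ?_)
  · exact (ENNReal.continuous_coe.comp (f.continuous.comp (h₂ q))).measurable
  · exact_mod_cast BoundedContinuousFunction.NNReal.upper_bound f (φ q y)
  · simp [ENNReal.mul_eq_top]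
  · exact ((ENNReal.continuous_coe.comp (f.continuous.comp (h₁ y))).tendsto p)

/-- A weakly continuous family of finite measures is measurable. -/
theorem MeasureTheory.FiniteMeasure.measurable_apply_of_continuous [HasOuterApproxClosed W] [MeasurableSpace P]
    [BorelSpace P] {v : P → FiniteMeasure W} (hv : Continuous v) {A : Set W}
    (hA : MeasurableSet A) : Measurable (fun p => (v p : Measure W) A) := by
  have hlin : ∀ f : BoundedContinuousFunction W NNReal,
      Measurable fun p => ∫⁻ w, f w ∂(v p : Measure W) := fun f =>
    (FiniteMeasure.continuous_iff_forall_continuous_lintegral.1 hv f).measurable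
  have hclosed : ∀ F : Set W, IsClosed F → Measurable (fun p => (v p : Measure W) F) := by
    intro F hF
    exact measurable_of_tendsto_metrizable (fun n => hlin (hF.apprSeq n))
      (tendsto_pi_nhds.2 fun p => HasOuterApproxClosed.tendsto_lintegral_apprSeq hF (v p : Measure W))
  suffices Measurable fun p => (v p : Measure W) from
    (Measure.measurable_coe hA).comp this
  refine Measurable.measure_of_isPiSystem (S := {F | IsClosed F}) ?_ ?_ ?_ ?_
  · rw [BorelSpace.measurable_eq (α := W), borel_eq_generateFrom_isClosed]
  · exact fun s hs t ht _ => IsClosed.inter hs ht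
  · exact hclosed
  · exact hclosed _ isClosed_univ

end WeakContinuity

/-! ### From almost everywhere to everywhere on the support -/

section Support

variable {Z : Type*} [TopologicalSpace Z] [MeasurableSpace Z] {μ : Measure Z}

theorem eqOn_support_of_ae_eq {X : Type*} [TopologicalSpace X] [T2Space X] {f g : Z → X}
    (hf : Continuous f) (hg : Continuous g) (h : f =ᵐ[μ] g) {z : Z} (hz : z ∈ μ.support) :
    f z = g z :=
  Measure.support_subset_of_isClosed (isClosed_eq hf hg) h hz

/-- The support lies in every closed set of full measure. This is the step that upgrades
almost-everywhere constraints to all times or all directions. -/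
theorem mem_of_ae_mem_of_isClosed (hμ : μ.support = Set.univ) {s : Set Z} (hs : IsClosed s)
    (h : ∀ᵐ z ∂μ, z ∈ s) (z : Z) : z ∈ s :=
  Measure.support_subset_of_isClosed hs h (hμ ▸ Set.mem_univ z)

end Support

/-- A family in a compact set is continuous if its image under a continuous injection is. -/
theorem continuous_of_continuous_comp_of_isCompact {P X Y : Type*} [TopologicalSpace P]
    [TopologicalSpace X] [TopologicalSpace Y] [T2Space Y] {F : X → Y} (hF : Continuous F)
    (hinj : Function.Injective F) {K : Set X} (hK : IsCompact K) {v : P → X} (hv : ∀ p, v p ∈ K)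
    (hFv : Continuous fun p => F (v p)) : Continuous v := by
  have : CompactSpace K := isCompact_iff_compactSpace.1 hK
  have hemb := (hF.comp (continuous_subtype_val (p := (· ∈ K)))).isClosedEmbedding
    (hinj.comp Subtype.val_injective)
  have : Continuous fun p => (⟨v p, hv p⟩ : K) := hemb.isInducing.continuous_iff.2 hFv
  exact continuous_subtype_val.comp this

/-! ### Weak continuity of products with a fixed measure -/

section ProdContinuity

variable {Z Y : Type*} [TopologicalSpace Z] [MeasurableSpace Z] [BorelSpace Z]
  [SecondCountableTopology Z] [TopologicalSpace Y] [MeasurableSpace Y] [BorelSpace Y]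
  [SecondCountableTopology Y]

/-- Integrating a bounded continuous function in the fixed factor leaves a bounded continuous
function, which is an admissible test function for `ν`. -/
theorem MeasureTheory.FiniteMeasure.continuous_prod_left (μ : FiniteMeasure Z) :
    Continuous fun ν : FiniteMeasure Y => μ.prod ν := by
  rw [FiniteMeasure.continuous_iff_forall_continuous_integral]
  intro f
  have hbound : ∀ y, ‖∫ z, f (z, y) ∂(μ : Measure Z)‖ ≤ ‖f‖ * (μ : Measure Z).real Set.univ :=
    fun y => norm_integral_le_of_norm_le_const (.of_forall fun z => f.norm_coe_le_norm _)
  have hcont : Continuous fun y => ∫ z, f (z, y) ∂(μ : Measure Z) :=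
    continuous_of_dominated (bound := fun _ => ‖f‖)
      (fun y => (f.continuous.comp (by fun_prop)).aestronglyMeasurable)
      (fun y => .of_forall fun z => f.norm_coe_le_norm _) (integrable_const _)
      (.of_forall fun z => f.continuous.comp (by fun_prop))
  have : ∀ ν : FiniteMeasure Y, ∫ p, f p ∂(μ.prod ν : Measure (Z × Y)) =
      ∫ y, BoundedContinuousFunction.ofNormedAddCommGroup _ hcont _ hbound y ∂(ν : Measure Y) :=
    fun ν => integral_prod_symm _ (f.integrable _)
  simp_rw [this]
  exact FiniteMeasure.continuous_integral_boundedContinuousFunction _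

theorem MeasureTheory.FiniteMeasure.continuous_prod_right (ν : FiniteMeasure Y) :
    Continuous fun μ : FiniteMeasure Z => μ.prod ν := by
  simp_rw [← FiniteMeasure.prod_swap ν]
  exact (FiniteMeasure.continuous_map continuous_swap).comp (FiniteMeasure.continuous_prod_left ν)

end ProdContinuity

/-! ### Radon transform and move operators: slices, continuity, mass, injectivity -/

section Operators

variable {d : ℕ} {Ω : Set (EuclideanSpace ℝ (Fin d))} {S : Set ℝ}
  {Θ : Set (EuclideanSpace ℝ (Fin d))} {G : Set (ℝ × ℝ)}

/-- The move operator at time `t` acting on every direction slice of a measure. -/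
noncomputable def moveDirections (t : ℝ) (γ : FiniteMeasure (Θ × G)) : FiniteMeasure (Θ × ℝ) :=
  γ.map (fun p : Θ × G => (p.1, (p.2 : ℝ × ℝ).1 + t * (p.2 : ℝ × ℝ).2))

theorem isLeftProduct_radon (HΘ : ProbabilityMeasure Θ) (u : FiniteMeasure Ω) :
    IsLeftProduct HΘ (fun θ : Θ => radonAt (θ : EuclideanSpace ℝ (Fin d)) u) (radon HΘ u) :=
  (isLeftProduct_prod HΘ u).map (φ := fun p : Θ × Ω =>
    (inner ℝ (p.1 : EuclideanSpace ℝ (Fin d)) (p.2 : EuclideanSpace ℝ (Fin d)) : ℝ))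
    (Continuous.measurable (by fun_prop))

theorem IsLeftProduct.moveDirections {HΘ : ProbabilityMeasure Θ} {g : Θ → FiniteMeasure G}
    {γ : FiniteMeasure (Θ × G)} (h : IsLeftProduct HΘ g γ) (t : ℝ) :
    IsLeftProduct HΘ (fun θ => moveAt t (g θ)) (moveDirections t γ) :=
  h.map (φ := fun p : Θ × G => (p.2 : ℝ × ℝ).1 + t * (p.2 : ℝ × ℝ).2)
    (Continuous.measurable (by fun_prop))

theorem isRightProduct_move (HS : ProbabilityMeasure S) (g : FiniteMeasure G) :
    IsRightProduct (fun t : S => moveAt (t : ℝ) g) HS (move HS g) := by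
  rw [isRightProduct_iff_swap]
  have h := (isLeftProduct_prod HS g).map (φ := fun p : S × G =>
    (p.2 : ℝ × ℝ).1 + (p.1 : ℝ) * (p.2 : ℝ × ℝ).2) (Continuous.measurable (by fun_prop))
  suffices heq : (move HS g).map Prod.swap = (HS.toFiniteMeasure.prod g).map fun p : S × G =>
      (p.1, (p.2 : ℝ × ℝ).1 + (p.1 : ℝ) * (p.2 : ℝ × ℝ).2) by
    rw [heq]
    exact h
  have hmove : move HS g = (g.prod HS.toFiniteMeasure).map (fun p : G × S =>
    ((p.1 : ℝ × ℝ).1 + (p.2 : ℝ) * (p.1 : ℝ × ℝ).2, p.2)) := rfl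
  rw [hmove, ← FiniteMeasure.prod_swap HS.toFiniteMeasure g]
  refine Subtype.ext ?_
  change Measure.map _ (Measure.map _ (Measure.map _ _)) = Measure.map _ _
  rw [Measure.map_map (Continuous.measurable (by fun_prop)) measurable_swap,
    Measure.map_map measurable_swap (Continuous.measurable (by fun_prop))]
  rfl

/-- Both sides of the identity are left products with the slices being compared, and a left product
determines its slices almost everywhere. The identity no longer mentions slices, so it passes to
weak limits. -/
theorem ae_moveAt_eq_radonAt_iff {HΘ : ProbabilityMeasure Θ} {g : Θ → FiniteMeasure G}
    {γ : FiniteMeasure (Θ × G)} (h : IsLeftProduct HΘ g γ) (t : ℝ) (u : FiniteMeasure Ω) :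
    (∀ᵐ (θ : Θ) ∂(HΘ : Measure Θ),
      moveAt t (g θ) = radonAt (θ : EuclideanSpace ℝ (Fin d)) u) ↔
    moveDirections t γ = radon HΘ u := by
  refine ⟨fun H => ?_, fun H => ?_⟩
  · exact ((h.moveDirections t).congr H).unique (isLeftProduct_radon HΘ u)
  · exact (h.moveDirections t).ae_eq (H ▸ isLeftProduct_radon HΘ u)

theorem continuous_radonAt_direction (u : FiniteMeasure Ω) :
    Continuous fun θ : EuclideanSpace ℝ (Fin d) => radonAt θ u :=
  u.continuous_map_of_continuous (fun _ => by fun_prop) (fun _ => by fun_prop)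

theorem continuous_moveAt_time (g : FiniteMeasure G) : Continuous fun t : ℝ => moveAt t g :=
  g.continuous_map_of_continuous (fun _ => by fun_prop) (fun _ => by fun_prop)

theorem continuous_moveDirections_time (γ : FiniteMeasure (Θ × G)) :
    Continuous fun t : ℝ => moveDirections t γ :=
  γ.continuous_map_of_continuous (fun _ => by fun_prop) (fun _ => by fun_prop)

theorem continuous_radonAt (θ : EuclideanSpace ℝ (Fin d)) :
    Continuous fun u : FiniteMeasure Ω => radonAt θ u :=
  FiniteMeasure.continuous_map (by fun_prop)

theorem continuous_moveAt (t : ℝ) : Continuous fun g : FiniteMeasure G => moveAt t g :=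
  FiniteMeasure.continuous_map (by fun_prop)

theorem continuous_moveDirections (t : ℝ) :
    Continuous fun γ : FiniteMeasure (Θ × G) => moveDirections t γ :=
  FiniteMeasure.continuous_map (by fun_prop)

theorem continuous_radon (HΘ : ProbabilityMeasure Θ) :
    Continuous fun u : FiniteMeasure Ω => radon HΘ u :=
  (FiniteMeasure.continuous_map (by fun_prop)).comp (FiniteMeasure.continuous_prod_left _)

theorem continuous_move (HS : ProbabilityMeasure S) :
    Continuous fun g : FiniteMeasure G => move HS g :=
  (FiniteMeasure.continuous_map (by fun_prop)).comp (FiniteMeasure.continuous_prod_right _)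

theorem mass_radonAt (θ : EuclideanSpace ℝ (Fin d)) (u : FiniteMeasure Ω) :
    (radonAt θ u).mass = u.mass :=
  u.mass_map (Continuous.measurable (by fun_prop))

theorem mass_moveAt (t : ℝ) (g : FiniteMeasure G) : (moveAt t g).mass = g.mass :=
  g.mass_map (Continuous.measurable (by fun_prop))

theorem mass_moveDirections (t : ℝ) (γ : FiniteMeasure (Θ × G)) :
    (moveDirections t γ).mass = γ.mass :=
  γ.mass_map (Continuous.measurable (by fun_prop))

theorem mass_radon (HΘ : ProbabilityMeasure Θ) (u : FiniteMeasure Ω) :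
    (radon HΘ u).mass = u.mass :=
  (isLeftProduct_radon HΘ u).mass_eq (.of_forall fun _ => mass_radonAt _ u)

theorem map_fst_moveDirections (t : ℝ) (γ : FiniteMeasure (Θ × G)) :
    (moveDirections t γ).map Prod.fst = γ.map Prod.fst := by
  refine Subtype.ext ?_
  change Measure.map _ (Measure.map _ _) = Measure.map _ _
  rw [Measure.map_map measurable_fst (Continuous.measurable (by fun_prop))]
  rfl

/-- Together with `map_fst_moveDirections` this shows that the constraint at one time forces the
direction marginal of `γ` to be a multiple of `HΘ`, so that `γ` disintegrates. -/
theorem map_fst_radon (HΘ : ProbabilityMeasure Θ) (u : FiniteMeasure Ω) :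
    (radon HΘ u).map Prod.fst = u.mass • HΘ.toFiniteMeasure := by
  rw [show u.mass • HΘ.toFiniteMeasure = (HΘ.toFiniteMeasure.prod u).map Prod.fst from
    (FiniteMeasure.map_fst_prod _ _).symm]
  refine Subtype.ext ?_
  change Measure.map _ (Measure.map _ _) = Measure.map _ _
  rw [Measure.map_map measurable_fst (Continuous.measurable (by fun_prop))]
  rfl

/-- Injectivity is assumed on signed measures but used on nonnegative ones. -/
theorem toSignedMeasure_map {X Y : Type*} [MeasurableSpace X] [MeasurableSpace Y]
    {f : X → Y} (hf : Measurable f) (ν : FiniteMeasure X) :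
    (ν : Measure X).toSignedMeasure.map f = ((ν.map f : FiniteMeasure Y) : Measure Y).toSignedMeasure := by
  ext A hA
  rw [VectorMeasure.map_apply _ hf hA, Measure.toSignedMeasure_apply_measurable (hf hA),
    Measure.toSignedMeasure_apply_measurable hA, Measure.real, Measure.real,
    FiniteMeasure.toMeasure_map, Measure.map_apply hf hA]

/-- Equal transforms have equal slices in almost every direction. Slices depend continuously on the
direction, so they agree on the support of `HΘ`, which is exactly where the hypothesis asks for
equality. -/
theorem RadonInjective.radon_injective {HΘ : ProbabilityMeasure Θ} (h : RadonInjective Ω HΘ) :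
    Function.Injective fun u : FiniteMeasure Ω => radon HΘ u := by
  intro u u' huu
  have hae := (isLeftProduct_radon HΘ u).ae_eq (γ := radon HΘ u)
    ((show radon HΘ u = radon HΘ u' from huu) ▸ isLeftProduct_radon HΘ u')
  have := @h (u : Measure Ω).toSignedMeasure (u' : Measure Ω).toSignedMeasure <| by
    ext1 θ
    have := eqOn_support_of_ae_eq ((continuous_radonAt_direction u).comp continuous_subtype_val)
      ((continuous_radonAt_direction u').comp continuous_subtype_val) hae θ.2
    dsimp only
    rw [toSignedMeasure_map (Continuous.measurable (by fun_prop)),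
      toSignedMeasure_map (Continuous.measurable (by fun_prop))]
    exact congrArg (fun ν : FiniteMeasure ℝ => (ν : Measure ℝ).toSignedMeasure) this
  exact FiniteMeasure.toMeasure_injective (Measure.toSignedMeasure_eq_toSignedMeasure_iff.1 this)

theorem MoveInjective.eq_of_moveAt_eq {HS : ProbabilityMeasure S} (h : MoveInjective G HS)
    {g g' : FiniteMeasure G} (hg : ∀ᵐ t : S ∂(HS : Measure S), moveAt (t : ℝ) g = moveAt (t : ℝ) g') :
    g = g' := by
  have := @h (g : Measure G).toSignedMeasure (g' : Measure G).toSignedMeasure <| by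
    ext1 t
    have := eqOn_support_of_ae_eq ((continuous_moveAt_time g).comp continuous_subtype_val)
      ((continuous_moveAt_time g').comp continuous_subtype_val) hg t.2
    dsimp only
    rw [toSignedMeasure_map (Continuous.measurable (by fun_prop)),
      toSignedMeasure_map (Continuous.measurable (by fun_prop))]
    exact congrArg (fun ν : FiniteMeasure ℝ => (ν : Measure ℝ).toSignedMeasure) this
  exact FiniteMeasure.toMeasure_injective (Measure.toSignedMeasure_eq_toSignedMeasure_iff.1 this)

theorem MoveInjective.move_injective {HS : ProbabilityMeasure S} (h : MoveInjective G HS) :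
    Function.Injective fun g : FiniteMeasure G => move HS g := by
  intro g g' hgg
  exact h.eq_of_moveAt_eq ((isRightProduct_move HS g).ae_eq
    ((show move HS g = move HS g' from hgg) ▸ isRightProduct_move HS g'))

end Operators

/-! ### Comparing minimization problems -/

section Solutions

/-- Admissible points of equal energy in two minimization problems are simultaneously solutions if
every energy of the second problem is attained in the first. -/
theorem IsSolution.transfer {X Y : Type*} {Adm : X → Prop} {E : X → ℝ≥0∞} {Adm' : Y → Prop}
    {E' : Y → ℝ≥0∞} (h : ∀ y, Adm' y → ∃ x, Adm x ∧ E x = E' y) {x : X} {y : Y}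
    (hx : IsSolution Adm E x) (hy : Adm' y) (hE : E' y = E x) : IsSolution Adm' E' y := by
  refine ⟨hy, hE ▸ hx.2.1, fun z hz => ?_⟩
  obtain ⟨w, hw, hwz⟩ := h z hz
  rw [hE, ← hwz]
  exact hx.2.2 w hw

end Solutions

/-! ### Snapshots at all times: mixed versus measure/measure model -/

section TimeSlices

variable {d : ℕ} {Ω : Set (EuclideanSpace ℝ (Fin d))} {S : Set ℝ}
  {Θ : Set (EuclideanSpace ℝ (Fin d))} {G : Set (ℝ × ℝ)}
  {HS : ProbabilityMeasure S} {HΘ : ProbabilityMeasure Θ}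

theorem mixedAdmissible_iff {γ : FiniteMeasure (Θ × G)} {u : S → FiniteMeasure Ω} :
    MixedAdmissible HΘ (γ, u) ↔ (∃ g : Θ → FiniteMeasure G, IsLeftProduct HΘ g γ) ∧
      ∀ t : S, moveDirections (t : ℝ) γ = radon HΘ (u t) := by
  refine ⟨fun ⟨g, hg, h⟩ => ⟨⟨g, hg⟩, fun t => (ae_moveAt_eq_radonAt_iff hg t _).1 (h t)⟩,
    fun ⟨⟨g, hg⟩, h⟩ => ⟨g, hg, fun t => (ae_moveAt_eq_radonAt_iff hg t _).2 (h t)⟩⟩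

theorem MixedAdmissible.mass_eq {γ : FiniteMeasure (Θ × G)} {u : S → FiniteMeasure Ω}
    (h : MixedAdmissible HΘ (γ, u)) (t : S) : (u t).mass = γ.mass := by
  rw [← mass_radon HΘ, ← (mixedAdmissible_iff.1 h).2 t, mass_moveDirections]

theorem ProductAdmissible.mass_eq {g : Θ → FiniteMeasure G} {u : S → FiniteMeasure Ω}
    (h : ProductAdmissible (g, u)) (t : S) (θ : Θ) : (g θ).mass = (u t).mass := by
  rw [← mass_moveAt (t : ℝ), h t θ, mass_radonAt]

theorem IsTimeSlices.unique (hS : (HS : Measure S).support = Set.univ)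
    (hR : RadonInjective Ω HΘ) {u : FiniteMeasure (Ω × S)} {v v' : S → FiniteMeasure Ω}
    (hv : IsTimeSlices HS HΘ u v) (hv' : IsTimeSlices HS HΘ u v') : v = v' := by
  ext1 t
  have hae := hv.1.ae_eq hv'.1
  exact hR.radon_injective (eqOn_support_of_ae_eq hv.2 hv'.2
    (hae.mono fun t ht => congrArg (radon HΘ) ht) (hS ▸ Set.mem_univ t))

theorem IsTimeSlices.timeSlices_eq (hS : (HS : Measure S).support = Set.univ)
    (hR : RadonInjective Ω HΘ) {u : FiniteMeasure (Ω × S)} {v : S → FiniteMeasure Ω}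
    (hv : IsTimeSlices HS HΘ u v) : timeSlices HS HΘ u = v := by
  have h : ∃ v, IsTimeSlices HS HΘ u v := ⟨v, hv⟩
  rw [timeSlices, dif_pos h]
  exact h.choose_spec.unique hS hR hv

/-- The snapshots of an admissible measure extend to all times. -/
theorem MeasureAdmissible.exists_radon_eq [CompactSpace Ω]
    (hS : (HS : Measure S).support = Set.univ) {γ : FiniteMeasure (Θ × G)}
    {u : FiniteMeasure (Ω × S)} (h : MeasureAdmissible HS HΘ (γ, u)) (t : S) :
    ∃ w : FiniteMeasure Ω, moveDirections (t : ℝ) γ = radon HΘ w := by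
  obtain ⟨g, v, hg, -, hae⟩ := h
  -- The mass bound costs nothing, since the constraint preserves mass, and it makes the image
  -- compact and therefore closed.
  have hclosed : IsClosed ((fun w : FiniteMeasure Ω => radon HΘ w) '' {w | w.mass ≤ γ.mass}) :=
    ((isCompact_setOfPred_finiteMeasure_le_of_compactSpace Ω γ.mass).image
      (continuous_radon HΘ)).isClosed
  have hmem := mem_of_ae_mem_of_isClosed hS (hclosed.preimage
    ((continuous_moveDirections_time γ).comp continuous_subtype_val)) (hae.mono fun t ht => by
      have heq := (ae_moveAt_eq_radonAt_iff hg t (v t)).1 ht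
      refine ⟨v t, ?_, heq.symm⟩
      rw [Set.mem_ofPred_eq, ← mass_radon HΘ, ← heq, mass_moveDirections]) t
  obtain ⟨w, -, hw⟩ := hmem
  exact ⟨w, hw.symm⟩

/-- The extended snapshots `w` have the same Radon transforms as the given ones at almost every
time, so by injectivity they represent `u`. Their transforms are continuous in time because
`moveDirections t γ` is. -/
theorem MeasureAdmissible.exists_isTimeSlices [CompactSpace Ω]
    (hS : (HS : Measure S).support = Set.univ) (hR : RadonInjective Ω HΘ)
    {γ : FiniteMeasure (Θ × G)} {u : FiniteMeasure (Ω × S)}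
    (h : MeasureAdmissible HS HΘ (γ, u)) :
    ∃ w : S → FiniteMeasure Ω, IsTimeSlices HS HΘ u w ∧ MixedAdmissible HΘ (γ, w) := by
  choose w hw using h.exists_radon_eq hS
  obtain ⟨g, v, hg, hv, hae⟩ := h
  refine ⟨w, ⟨hv.congr (hae.mono fun t ht => hR.radon_injective ?_), ?_⟩,
    mixedAdmissible_iff.2 ⟨⟨g, hg⟩, hw⟩⟩
  · exact ((ae_moveAt_eq_radonAt_iff hg t (v t)).1 ht).symm.trans (hw t)
  · simp_rw [← hw]
    exact (continuous_moveDirections_time γ).comp continuous_subtype_val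

/-- The constraint makes the Radon transforms of the snapshots continuous in time. Equal masses
confine the snapshots to a compact set, on which the injective Radon transform is an embedding, so
the snapshots are continuous and hence measurable in time. -/
theorem MixedAdmissible.exists_isTimeSlices [CompactSpace Ω] (hR : RadonInjective Ω HΘ)
    {γ : FiniteMeasure (Θ × G)} {v : S → FiniteMeasure Ω} (h : MixedAdmissible HΘ (γ, v)) :
    ∃ u : FiniteMeasure (Ω × S), IsTimeSlices HS HΘ u v ∧ MeasureAdmissible HS HΘ (γ, u) := by
  have hrad : Continuous fun t => radon HΘ (v t) := by
    simp_rw [← (mixedAdmissible_iff.1 h).2]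
    exact (continuous_moveDirections_time γ).comp continuous_subtype_val
  have hv : Continuous v := continuous_of_continuous_comp_of_isCompact (continuous_radon HΘ)
    hR.radon_injective (isCompact_setOfPred_finiteMeasure_le_of_compactSpace Ω γ.mass)
    (fun t => (h.mass_eq t).le) hrad
  obtain ⟨u, hu⟩ := exists_isRightProduct HS
    (fun A hA => FiniteMeasure.measurable_apply_of_continuous hv hA) fun t => (h.mass_eq t).le
  obtain ⟨g, hg, hgv⟩ := h
  exact ⟨u, ⟨hu, hrad⟩, g, v, hg, hu, .of_forall hgv⟩

theorem measureEnergy_eq_mixedEnergy {H : Type*} [NormedAddCommGroup H] [InnerProductSpace ℝ H]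
    {T : Finset S} (hS : (HS : Measure S).support = Set.univ) (hR : RadonInjective Ω HΘ)
    (Ob : T → FiniteMeasure Ω → H) (f : T → H) (α : ℝ) (γ : FiniteMeasure (Θ × G))
    {u : FiniteMeasure (Ω × S)} {v : S → FiniteMeasure Ω} (hv : IsTimeSlices HS HΘ u v) :
    measureEnergy HS HΘ Ob f α (γ, u) = mixedEnergy Ob f α (γ, v) := by
  simp only [measureEnergy, mixedEnergy, hv.timeSlices_eq hS hR]

section Equivalence

variable [CompactSpace Ω] {H : Type*} [NormedAddCommGroup H] [InnerProductSpace ℝ H]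
    {T : Finset S} {Ob : T → FiniteMeasure Ω → H} {f : T → H} {α : ℝ}

theorem IsSolution.measure_of_mixed (hS : (HS : Measure S).support = Set.univ)
    (hR : RadonInjective Ω HΘ) {γ : FiniteMeasure (Θ × G)} {v : S → FiniteMeasure Ω}
    (h : IsSolution (MixedAdmissible HΘ) (mixedEnergy Ob f α) (γ, v)) :
    ∃ u : FiniteMeasure (Ω × S), IsTimeSlices HS HΘ u v ∧
      IsSolution (MeasureAdmissible HS HΘ) (measureEnergy HS HΘ Ob f α) (γ, u) := by
  obtain ⟨u, hu, hadm⟩ := h.1.exists_isTimeSlices (HS := HS) hR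
  refine ⟨u, hu, h.transfer (fun y hy => ?_) hadm (measureEnergy_eq_mixedEnergy hS hR Ob f α γ hu)⟩
  obtain ⟨w, hw, hw'⟩ := MeasureAdmissible.exists_isTimeSlices hS hR hy
  exact ⟨(y.1, w), hw', (measureEnergy_eq_mixedEnergy hS hR Ob f α y.1 hw).symm⟩

theorem IsSolution.mixed_of_measure (hS : (HS : Measure S).support = Set.univ)
    (hR : RadonInjective Ω HΘ) {γ : FiniteMeasure (Θ × G)} {u : FiniteMeasure (Ω × S)}
    (h : IsSolution (MeasureAdmissible HS HΘ) (measureEnergy HS HΘ Ob f α) (γ, u)) :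
    ∃ v : S → FiniteMeasure Ω, IsTimeSlices HS HΘ u v ∧
      IsSolution (MixedAdmissible HΘ) (mixedEnergy Ob f α) (γ, v) := by
  obtain ⟨v, hv, hadm⟩ := h.1.exists_isTimeSlices hS hR
  refine ⟨v, hv, h.transfer (fun y hy => ?_) hadm
    (measureEnergy_eq_mixedEnergy hS hR Ob f α γ hv).symm⟩
  obtain ⟨u', hu', hadm'⟩ := MixedAdmissible.exists_isTimeSlices (HS := HS) hR hy
  exact ⟨(y.1, u'), hadm', measureEnergy_eq_mixedEnergy hS hR Ob f α y.1 hu'⟩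

end Equivalence

end TimeSlices

/-! ### Projections in all directions: product/product versus mixed model -/

section DirectionSlices

variable {d : ℕ} {Ω : Set (EuclideanSpace ℝ (Fin d))} {S : Set ℝ}
  {Θ : Set (EuclideanSpace ℝ (Fin d))} {G : Set (ℝ × ℝ)}
  {HS : ProbabilityMeasure S} {HΘ : ProbabilityMeasure Θ}

theorem IsDirectionSlices.unique (hΘ : (HΘ : Measure Θ).support = Set.univ)
    (hM : MoveInjective G HS) {γ : FiniteMeasure (Θ × G)} {g g' : Θ → FiniteMeasure G}
    (hg : IsDirectionSlices HS HΘ γ g) (hg' : IsDirectionSlices HS HΘ γ g') : g = g' := by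
  ext1 θ
  have hae := hg.1.ae_eq hg'.1
  exact hM.move_injective (eqOn_support_of_ae_eq hg.2 hg'.2
    (hae.mono fun t ht => congrArg (_root_.move HS) ht) (hΘ ▸ Set.mem_univ θ))

/-- All times together form one continuous injective map into a product of spaces of measures. The
constraint turns its values on `g θ` into Radon transforms of fixed snapshots, which are continuous
in the direction. -/
theorem ProductAdmissible.continuous [CompactSpace G] (hM : MoveInjective G HS)
    {g : Θ → FiniteMeasure G} {u : S → FiniteMeasure Ω} (h : ProductAdmissible (g, u)) :
    Continuous g := by
  obtain ⟨t⟩ := HS.nonempty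
  refine continuous_of_continuous_comp_of_isCompact (F := fun μ (t : S) => moveAt (t : ℝ) μ)
    (continuous_pi fun t => continuous_moveAt _)
    (fun μ μ' hμ => hM.eq_of_moveAt_eq (.of_forall fun t => congrFun hμ t))
    (isCompact_setOfPred_finiteMeasure_le_of_compactSpace G (u t).mass)
    (fun θ => (h.mass_eq t θ).le) (continuous_pi fun t => ?_)
  simp_rw [h t _]
  exact (continuous_radonAt_direction (u t)).comp continuous_subtype_val

/-- For countably many times, the constraint of the mixed model can be satisfied in every
direction. -/
theorem MixedAdmissible.exists_moveAt_eq [CompactSpace G]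
    (hΘ : (HΘ : Measure Θ).support = Set.univ) {γ : FiniteMeasure (Θ × G)}
    {u : S → FiniteMeasure Ω} (h : MixedAdmissible HΘ (γ, u)) {C : Set S} (hC : C.Countable)
    (θ : Θ) : ∃ μ : FiniteMeasure G, ∀ t ∈ C,
      moveAt (t : ℝ) μ = radonAt (θ : EuclideanSpace ℝ (Fin d)) (u t) := by
  obtain ⟨g, hg, hgu⟩ := h
  rcases C.eq_empty_or_nonempty with rfl | ⟨t₀, ht₀⟩
  · exact ⟨0, by simp⟩
  have hclosed : IsClosed ((fun (μ : FiniteMeasure G) (t : C) => moveAt ((t : S) : ℝ) μ) ''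
      {μ | μ.mass ≤ (u t₀).mass}) :=
    ((isCompact_setOfPred_finiteMeasure_le_of_compactSpace G (u t₀).mass).image
      (continuous_pi fun t => continuous_moveAt _)).isClosed
  have hcont : Continuous fun (θ : Θ) (t : C) =>
      radonAt (θ : EuclideanSpace ℝ (Fin d)) (u t) :=
    continuous_pi fun t => (continuous_radonAt_direction _).comp continuous_subtype_val
  have hae : ∀ᵐ θ : Θ ∂(HΘ : Measure Θ), ∀ t ∈ C,
      moveAt (t : ℝ) (g θ) = radonAt (θ : EuclideanSpace ℝ (Fin d)) (u t) :=
    (ae_ball_iff hC).2 fun t _ => hgu t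
  obtain ⟨μ, -, hμ⟩ := mem_of_ae_mem_of_isClosed hΘ (hclosed.preimage hcont)
    (hae.mono fun θ hθ => by
      refine ⟨g θ, ?_, funext fun t => hθ t t.2⟩
      rw [Set.mem_ofPred_eq, ← mass_moveAt (t₀ : ℝ), hθ t₀ ht₀, mass_radonAt]) θ
  exact ⟨μ, fun t ht => congrFun hμ ⟨t, ht⟩⟩

theorem MixedAdmissible.exists_isDirectionSlices [CompactSpace G]
    (hΘ : (HΘ : Measure Θ).support = Set.univ) (hM : MoveInjective G HS)
    {γ : FiniteMeasure (Θ × G)} {u : S → FiniteMeasure Ω} (h : MixedAdmissible HΘ (γ, u)) :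
    ∃ g : Θ → FiniteMeasure G, IsDirectionSlices HS HΘ γ g ∧ ProductAdmissible (g, u) := by
  -- The exceptional directions depend on the time, so only countably many times can be treated at
  -- once. A dense set suffices to determine a measure, because `moveAt` is continuous in time.
  obtain ⟨D, hDc, hDd⟩ := TopologicalSpace.exists_countable_dense S
  have hext : ∀ μ μ' : FiniteMeasure G, (∀ t ∈ D, moveAt (t : ℝ) μ = moveAt (t : ℝ) μ') →
      μ = μ' := fun μ μ' hμ => hM.eq_of_moveAt_eq <| .of_forall <| congrFun <|
    Continuous.ext_on hDd ((continuous_moveAt_time μ).comp continuous_subtype_val)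
      ((continuous_moveAt_time μ').comp continuous_subtype_val) hμ
  choose g hg using fun θ => h.exists_moveAt_eq hΘ hDc θ
  have hprod : ProductAdmissible (g, u) := by
    intro t θ
    -- Adjoining the one time `t` keeps the set countable. The measure found agrees with `g θ` at
    -- the dense times, hence equals it, and satisfies the constraint at `t` as well; no continuity
    -- of `u` in time is needed.
    obtain ⟨μ, hμ⟩ := h.exists_moveAt_eq hΘ (hDc.insert t) θ
    have : g θ = μ := hext _ _ fun s hs =>
      (hg θ s hs).trans (hμ s (Set.mem_insert_of_mem _ hs)).symm
    dsimp only
    rw [this]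
    exact hμ t (Set.mem_insert _ _)
  obtain ⟨g₀, hg₀, hgu⟩ := h
  refine ⟨g, ⟨hg₀.congr ?_, (continuous_move HS).comp (hprod.continuous hM)⟩, hprod⟩
  filter_upwards [(ae_ball_iff hDc).2 fun t _ => hgu t] with θ hθ
  exact hext _ _ fun t ht => (hθ t ht).trans (hg θ t ht).symm

theorem ProductAdmissible.exists_isDirectionSlices [CompactSpace G] (hM : MoveInjective G HS)
    {g : Θ → FiniteMeasure G} {u : S → FiniteMeasure Ω} (h : ProductAdmissible (g, u)) :
    ∃ γ : FiniteMeasure (Θ × G), IsDirectionSlices HS HΘ γ g ∧ MixedAdmissible HΘ (γ, u) := by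
  have hg := h.continuous hM
  obtain ⟨t⟩ := HS.nonempty
  obtain ⟨γ, hγ⟩ := exists_isLeftProduct HΘ
    (fun A hA => FiniteMeasure.measurable_apply_of_continuous hg hA) fun θ => (h.mass_eq t θ).le
  exact ⟨γ, ⟨hγ, (continuous_move HS).comp hg⟩, g, hγ, fun t => .of_forall fun θ => h t θ⟩

section Equivalence

variable {H : Type*} [NormedAddCommGroup H]
    {T : Finset S} {Ob : T → FiniteMeasure Ω → H} {f : T → H} {α : ℝ} {θ₀ : Θ}

/-- Mass preservation equates both regularizers with the mass of `u t`, so the choice of `θ₀` is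
immaterial. -/
theorem productEnergy_eq_mixedEnergy (t : S) {g : Θ → FiniteMeasure G}
    {γ : FiniteMeasure (Θ × G)} {u : S → FiniteMeasure Ω} (hg : ProductAdmissible (g, u))
    (hγ : MixedAdmissible HΘ (γ, u)) :
    productEnergy θ₀ Ob f α (g, u) = mixedEnergy Ob f α (γ, u) := by
  simp only [productEnergy, mixedEnergy, hg.mass_eq t, hγ.mass_eq t]

theorem IsSolution.product_of_mixed [CompactSpace G]
    (hΘ : (HΘ : Measure Θ).support = Set.univ) (hM : MoveInjective G HS)
    {γ : FiniteMeasure (Θ × G)} {u : S → FiniteMeasure Ω}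
    (h : IsSolution (MixedAdmissible HΘ) (mixedEnergy Ob f α) (γ, u)) :
    ∃ g : Θ → FiniteMeasure G, IsDirectionSlices HS HΘ γ g ∧
      IsSolution ProductAdmissible (productEnergy θ₀ Ob f α) (g, u) := by
  obtain ⟨t⟩ := HS.nonempty
  obtain ⟨g, hg, hadm⟩ := h.1.exists_isDirectionSlices hΘ hM
  refine ⟨g, hg, h.transfer (fun y hy => ?_) hadm (productEnergy_eq_mixedEnergy t hadm h.1)⟩
  obtain ⟨γ', -, hadm'⟩ := ProductAdmissible.exists_isDirectionSlices (HΘ := HΘ) hM hy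
  exact ⟨(γ', y.2), hadm', (productEnergy_eq_mixedEnergy t hy hadm').symm⟩

theorem IsSolution.mixed_of_product [CompactSpace G]
    (hΘ : (HΘ : Measure Θ).support = Set.univ) (hM : MoveInjective G HS)
    {g : Θ → FiniteMeasure G} {u : S → FiniteMeasure Ω}
    (h : IsSolution ProductAdmissible (productEnergy θ₀ Ob f α) (g, u)) :
    ∃ γ : FiniteMeasure (Θ × G), IsDirectionSlices HS HΘ γ g ∧
      IsSolution (MixedAdmissible HΘ) (mixedEnergy Ob f α) (γ, u) := by
  obtain ⟨t⟩ := HS.nonempty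
  obtain ⟨γ, hγ, hadm⟩ := h.1.exists_isDirectionSlices (HΘ := HΘ) hM
  refine ⟨γ, hγ, h.transfer (fun y hy => ?_) hadm (productEnergy_eq_mixedEnergy t h.1 hadm).symm⟩
  obtain ⟨g', -, hadm'⟩ := MixedAdmissible.exists_isDirectionSlices hΘ hM hy
  exact ⟨(g', y.2), hadm', productEnergy_eq_mixedEnergy t hadm' hy⟩

end Equivalence

end DirectionSlices

/-! ### Existence of minimizers by the direct method -/

section Existence

/-- The direct method: a lower semicontinuous energy has a minimizer on a closed admissible set with
a compact sublevel. -/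
theorem exists_isSolution {X : Type*} [TopologicalSpace X] {Adm : X → Prop} {E : X → ℝ≥0∞}
    (hE : LowerSemicontinuous E) (hAdm : IsClosed {x | Adm x}) {K : Set X} (hK : IsCompact K)
    {x₀ : X} (h₀ : Adm x₀) (hfin : E x₀ < ⊤) (hsub : ∀ x, Adm x → E x ≤ E x₀ → x ∈ K) :
    ∃ x, IsSolution Adm E x := by
  obtain ⟨x, ⟨-, hx⟩, hmin⟩ := LowerSemicontinuousOn.exists_isMinOn (s := K ∩ {x | Adm x})
    ⟨x₀, hsub x₀ h₀ le_rfl, h₀⟩ (hK.inter_right hAdm) (hE.lowerSemicontinuousOn _)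
  have hmin' : ∀ y ∈ K ∩ {x | Adm x}, E x ≤ E y := fun y hy => hmin hy
  have hx₀ : E x ≤ E x₀ := hmin' x₀ ⟨hsub x₀ h₀ le_rfl, h₀⟩
  refine ⟨x, hx, hx₀.trans_lt hfin, fun y hy => ?_⟩
  rcases le_total (E y) (E x₀) with h | h
  · exact hmin' y ⟨hsub y hy h, hy⟩
  · exact hx₀.trans h

variable {d : ℕ} {Ω : Set (EuclideanSpace ℝ (Fin d))} {S : Set ℝ}
  {Θ : Set (EuclideanSpace ℝ (Fin d))} {G : Set (ℝ × ℝ)}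
  {H : Type*} [NormedAddCommGroup H]
  {T : Finset S} {Ob : T → FiniteMeasure Ω → H} {f : T → H} {α : ℝ}

theorem lowerSemicontinuous_mass_add {X Y : Type*} [TopologicalSpace X] [TopologicalSpace Y]
    [MeasurableSpace Y] [OpensMeasurableSpace Y] {μ : X → FiniteMeasure Y} (hμ : Continuous μ)
    {D : X → ℝ≥0∞} (hD : LowerSemicontinuous D) :
    LowerSemicontinuous fun x => ((μ x).mass : ℝ≥0∞) + D x :=
  (ENNReal.continuous_coe.comp (FiniteMeasure.continuous_mass.comp hμ)).lowerSemicontinuous.add hD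

theorem mass_le_toNNReal {Y : Type*} [MeasurableSpace Y] {μ : FiniteMeasure Y} {D C : ℝ≥0∞}
    (hC : C < ⊤) (h : (μ.mass : ℝ≥0∞) + D ≤ C) : μ.mass ≤ C.toNNReal := by
  rw [← ENNReal.coe_le_coe, ENNReal.coe_toNNReal hC.ne]
  exact le_self_add.trans h

/-- Tychonoff's theorem with an arbitrary index set: uncountably many times and directions are
allowed, so compactness is used in place of convergent subsequences. -/
theorem isCompact_pi_mass_le (ι : Type*) {Y : Type*} [TopologicalSpace Y] [T2Space Y]
    [MeasurableSpace Y] [BorelSpace Y] [CompactSpace Y] [HasOuterApproxClosed Y] (C : NNReal) :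
    IsCompact {v : ι → FiniteMeasure Y | ∀ i, (v i).mass ≤ C} := by
  have := isCompact_univ_pi fun _ : ι => isCompact_setOfPred_finiteMeasure_le_of_compactSpace Y C
  convert this using 1
  ext v
  simp

theorem exists_productAdmissible_isSolution [CompactSpace Ω] [CompactSpace G] (t₀ : S) (θ₀ : Θ)
    (hD : LowerSemicontinuous (fidelity Ob f α))
    {p₀ : (Θ → FiniteMeasure G) × (S → FiniteMeasure Ω)} (h₀ : ProductAdmissible p₀)
    (hfin : fidelity Ob f α p₀.2 < ⊤) :
    ∃ p : (Θ → FiniteMeasure G) × (S → FiniteMeasure Ω),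
      IsSolution ProductAdmissible (productEnergy θ₀ Ob f α) p := by
  have hfin' : productEnergy θ₀ Ob f α p₀ < ⊤ := ENNReal.add_lt_top.2 ⟨ENNReal.coe_lt_top, hfin⟩
  refine exists_isSolution (lowerSemicontinuous_mass_add
    ((continuous_apply θ₀).comp continuous_fst) (hD.comp continuous_snd)) ?_
    ((isCompact_pi_mass_le Θ (productEnergy θ₀ Ob f α p₀).toNNReal).prod
      (isCompact_pi_mass_le S (productEnergy θ₀ Ob f α p₀).toNNReal)) h₀ hfin' fun p hp hle => ?_
  · simp only [ProductAdmissible, Set.ofPred_forall]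
    refine isClosed_iInter fun t => isClosed_iInter fun θ => isClosed_eq
      ((continuous_moveAt _).comp ((continuous_apply θ).comp continuous_fst))
      ((continuous_radonAt _).comp ((continuous_apply t).comp continuous_snd))
  · have hmass := mass_le_toNNReal hfin' hle
    -- The energy sees only the direction `θ₀`; mass preservation spreads its bound to all
    -- directions and times.
    have hS : ∀ t, (p.2 t).mass = (p.1 θ₀).mass := fun t => (hp.mass_eq t θ₀).symm
    exact ⟨fun θ => by rwa [hp.mass_eq t₀ θ, hS], fun t => by rwa [hS]⟩

theorem exists_mixedAdmissible_isSolution [CompactSpace Ω] [CompactSpace Θ] [CompactSpace G]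
    (HΘ : ProbabilityMeasure Θ) (t₀ : S) (hD : LowerSemicontinuous (fidelity Ob f α))
    {p₀ : FiniteMeasure (Θ × G) × (S → FiniteMeasure Ω)} (h₀ : MixedAdmissible HΘ p₀)
    (hfin : fidelity Ob f α p₀.2 < ⊤) :
    ∃ p : FiniteMeasure (Θ × G) × (S → FiniteMeasure Ω),
      IsSolution (MixedAdmissible HΘ) (mixedEnergy Ob f α) p := by
  have hG : StandardBorelSpace G :=
    (isCompact_iff_compactSpace.2 ‹_› : IsCompact G).measurableSet.standardBorel
  have hfin' : mixedEnergy Ob f α p₀ < ⊤ := ENNReal.add_lt_top.2 ⟨ENNReal.coe_lt_top, hfin⟩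
  refine exists_isSolution (lowerSemicontinuous_mass_add continuous_fst (hD.comp continuous_snd)) ?_
    ((isCompact_setOfPred_finiteMeasure_le_of_compactSpace _ (mixedEnergy Ob f α p₀).toNNReal).prod
      (isCompact_pi_mass_le S (mixedEnergy Ob f α p₀).toNNReal)) h₀ hfin' fun p hp hle => ?_
  · have : {p : FiniteMeasure (Θ × G) × (S → FiniteMeasure Ω) | MixedAdmissible HΘ p} =
        ⋂ t : S, {p | moveDirections (t : ℝ) p.1 = radon HΘ (p.2 t)} := by
      ext p
      rw [Set.mem_ofPred_eq, mixedAdmissible_iff, Set.mem_iInter]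
      -- The disintegration requirement is automatic and need not be shown to be closed: the
      -- identity at the single time `t₀` already fixes the direction marginal.
      refine ⟨fun h => h.2, fun h => ⟨exists_isLeftProduct_of_fst (p.2 t₀).mass ?_, h⟩⟩
      rw [← map_fst_radon, ← h t₀, map_fst_moveDirections]
    rw [this]
    exact isClosed_iInter fun t => isClosed_eq ((continuous_moveDirections _).comp continuous_fst)
      ((continuous_radon HΘ).comp ((continuous_apply t).comp continuous_snd))
  · have hmass := mass_le_toNNReal hfin' hle
    exact ⟨hmass, fun t => by rwa [hp.mass_eq t]⟩

/-- The minimization of mass plus fidelity over unconstrained snapshots. -/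
theorem exists_snapshots_isSolution [CompactSpace Ω] [Subsingleton S] (t₀ : S)
    (hD : LowerSemicontinuous (fidelity Ob f α)) {w : S → FiniteMeasure Ω}
    (hfin : fidelity Ob f α w < ⊤) : ∃ v : S → FiniteMeasure Ω, IsSolution (fun _ => True)
      (fun v => ((v t₀).mass : ℝ≥0∞) + fidelity Ob f α v) v := by
  have hfin' : ((w t₀).mass : ℝ≥0∞) + fidelity Ob f α w < ⊤ :=
    ENNReal.add_lt_top.2 ⟨ENNReal.coe_lt_top, hfin⟩
  refine exists_isSolution (lowerSemicontinuous_mass_add (continuous_apply t₀) hD) (by simp)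
    (isCompact_pi_mass_le S (((w t₀).mass : ℝ≥0∞) + fidelity Ob f α w).toNNReal) trivial hfin' fun v _ hle t => ?_
  rw [Subsingleton.elim t t₀]
  exact mass_le_toNNReal hfin' hle

end Existence

/-! ### Lower semicontinuity of the fidelity term -/

section Fidelity

variable {d : ℕ} {Ω : Set (EuclideanSpace ℝ (Fin d))} {S : Set ℝ}
  {H : Type*} [NormedAddCommGroup H] [InnerProductSpace ℝ H]

theorem IsObservationOperator.continuous_inner [CompactSpace Ω] {Ob : FiniteMeasure Ω → H}
    (hOb : IsObservationOperator Ob) (h : H) : Continuous fun u => inner ℝ (Ob u) h := by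
  obtain ⟨A, hA⟩ := hOb
  simp_rw [hA]
  exact FiniteMeasure.continuous_integral_continuousMap (A h)

/-- Weak convergence of measures yields only weak convergence of the observations in `H`. It
therefore suffices to write the hard constraint and the squared norm through inner products with
fixed vectors. -/
theorem lowerSemicontinuous_fidelity [CompactSpace Ω] {T : Finset S} {Ob : T → FiniteMeasure Ω → H}
    (hOb : ∀ t, IsObservationOperator (Ob t)) (f : T → H) {α : ℝ} (hα : 0 ≤ α) :
    LowerSemicontinuous (fidelity Ob f α) := by
  have hcont : ∀ (t : T) (h : H),
      Continuous fun v : S → FiniteMeasure Ω => inner ℝ (Ob t (v t)) h := fun t h =>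
    ((hOb t).continuous_inner h).comp (continuous_apply (t : S))
  rcases hα.eq_or_lt with rfl | hα
  · have hclosed : IsClosed {v : S → FiniteMeasure Ω | ∀ t : T, Ob t (v t) = f t} := by
      have : {v : S → FiniteMeasure Ω | ∀ t : T, Ob t (v t) = f t} =
          ⋂ (t : T) (h : H), {v | inner ℝ (Ob t (v t)) h = inner ℝ (f t) h} := by
        ext v
        simp only [Set.mem_ofPred_eq, Set.mem_iInter]
        exact forall_congr' fun t => ⟨fun h x => by rw [h], fun h => ext_inner_right ℝ h⟩
      rw [this]
      exact isClosed_iInter fun t => isClosed_iInter fun h => isClosed_eq (hcont t h)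
        continuous_const
    rw [lowerSemicontinuous_iff_isOpen_preimage]
    intro y
    -- For `α = 0` the only values are `0` and `⊤`, so a strict superlevel set is empty or the
    -- complement of the constraint set.
    by_cases hy : y = ⊤
    · simp [hy]
    · convert hclosed.isOpen_compl using 1
      ext v
      simp only [fidelity, if_true, Set.mem_preimage, Set.mem_Ioi, Set.mem_compl_iff,
        Set.mem_ofPred_eq]
      split_ifs with hv
      · exact ⟨fun h => absurd h not_lt_zero, fun h => absurd hv h⟩
      · exact ⟨fun _ => hv, fun _ => lt_top_iff_ne_top.2 hy⟩
  -- Dual form `‖x‖² = sup_h (2⟨x, h⟩ - ‖h‖²)`, attained at `h = x`, which exhibits the fidelity as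
  -- a supremum of continuous functions.
  · have hsup : fidelity Ob f α = fun v => ⨆ h : T → H, ENNReal.ofReal (1 / (2 * α) *
        ∑ t : T, (2 * (inner ℝ (Ob t (v t)) (h t) - inner ℝ (f t) (h t)) - ‖h t‖ ^ 2)) := by
      ext v
      rw [fidelity, if_neg hα.ne']
      refine le_antisymm (le_iSup_of_le (fun t => Ob t (v t) - f t) (le_of_eq ?_))
        (iSup_le fun h => ?_)
      · congr 2
        refine Finset.sum_congr rfl fun t _ => ?_
        rw [← inner_sub_left, real_inner_self_eq_norm_sq]
        ring
      · gcongr with t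
        rw [← inner_sub_left]
        have := norm_sub_sq_real (Ob t (v t) - f t) (h t)
        nlinarith [sq_nonneg ‖Ob t (v t) - f t - h t‖]
    rw [hsup]
    exact lowerSemicontinuous_iSup fun h => Continuous.lowerSemicontinuous <|
      ENNReal.continuous_ofReal.comp <| continuous_const.mul <| continuous_finsetSum _ fun t _ =>
        (continuous_const.mul ((hcont t (h t)).sub continuous_const)).sub continuous_const

end Fidelity

/-! ### Phase space: compactness, degenerate times, admissible points -/

section PhaseSpace

variable {d : ℕ} {Ω : Set (EuclideanSpace ℝ (Fin d))} {S : Set ℝ}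
  {Θ : Set (EuclideanSpace ℝ (Fin d))}

theorem isClosed_phaseDomain (hΩ : IsClosed Ω) : IsClosed (phaseDomain Ω S) := by
  simp only [phaseDomain, Set.ofPred_forall]
  exact isClosed_iInter fun t => isClosed_iInter fun _ => hΩ.preimage (by fun_prop)

/-- Positions at two distinct times determine position and velocity continuously, so the domain is a
closed subset of a continuous image of `Ω × Ω`. -/
theorem isCompact_phaseDomain (hΩ : IsCompact Ω) (hS : S.Nontrivial) :
    IsCompact (phaseDomain Ω S) := by
  obtain ⟨s, hs, t, ht, hst⟩ := hS
  have hne : t - s ≠ 0 := sub_ne_zero.2 hst.symm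
  refine ((hΩ.prod hΩ).image (f := fun q => (q.1 - s • (t - s)⁻¹ • (q.2 - q.1),
    (t - s)⁻¹ • (q.2 - q.1))) (by fun_prop)).of_isClosed_subset
    (isClosed_phaseDomain hΩ.isClosed) fun p hp => ?_
  refine ⟨(p.1 + s • p.2, p.1 + t • p.2), ⟨hp s hs, hp t ht⟩, ?_⟩
  have : (t - s)⁻¹ • (p.1 + t • p.2 - (p.1 + s • p.2)) = p.2 := by
    rw [add_sub_add_left_eq_sub, ← sub_smul, inv_smul_smul₀ hne]
  simp only [this, add_sub_cancel_right]

theorem isCompact_projDomain (hΩ : IsCompact Ω) (hΘ : IsCompact Θ) (hS : S.Nontrivial) :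
    IsCompact (projDomain Ω S Θ) := by
  convert (hΘ.prod (isCompact_phaseDomain hΩ hS)).image (f := fun q : EuclideanSpace ℝ (Fin d) ×
    EuclideanSpace ℝ (Fin d) × EuclideanSpace ℝ (Fin d) =>
      ((inner ℝ q.1 q.2.1 : ℝ), (inner ℝ q.1 q.2.2 : ℝ))) (by fun_prop) using 1
  ext z
  constructor
  · rintro ⟨θ, hθ, p, hp, rfl⟩
    exact ⟨(θ, p), ⟨hθ, hp⟩, rfl⟩
  · rintro ⟨⟨θ, p⟩, ⟨hθ, hp⟩, rfl⟩
    exact ⟨θ, hθ, p, hp, rfl⟩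

/-- With a single time the move operator is injective only in the trivial case. -/
theorem MoveInjective.projDomain_eq_empty {HS : ProbabilityMeasure S}
    (hM : MoveInjective (projDomain Ω S Θ) HS) (hΘ : Θ ⊆ Metric.sphere 0 1)
    (hS : S.Subsingleton) : projDomain Ω S Θ = ∅ := by
  refine Set.eq_empty_of_forall_notMem ?_
  rintro z ⟨θ, hθ, p, hp, rfl⟩
  obtain ⟨s⟩ := HS.nonempty
  have hθθ : inner ℝ θ θ = (1 : ℝ) := by
    rw [real_inner_self_eq_norm_sq, mem_sphere_zero_iff_norm.1 (hΘ hθ), one_pow]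
  let z₁ : projDomain Ω S Θ := ⟨(inner ℝ θ p.1, inner ℝ θ p.2), θ, hθ, p, hp, rfl⟩
  -- Increasing the velocity by `θ` and moving the start back by `s • θ` leaves the position at the
  -- only time `s` unchanged. The Dirac masses at `z₁` and `z₂` are thus indistinguishable, while
  -- their velocity components differ by one.
  let z₂ : projDomain Ω S Θ := ⟨(inner ℝ θ (p.1 - (s : ℝ) • θ), inner ℝ θ (p.2 + θ)), θ, hθ,
    (p.1 - (s : ℝ) • θ, p.2 + θ), fun t ht => by
      rw [hS ht s.2]
      convert hp s s.2 using 1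
      simp only [smul_add]
      abel, rfl⟩
  let δ : projDomain Ω S Θ → FiniteMeasure (projDomain Ω S Θ) := fun z =>
    ⟨Measure.dirac z, inferInstance⟩
  have hδ : δ z₁ = δ z₂ := by
    refine hM.eq_of_moveAt_eq (.of_forall fun t => ?_)
    have hts : (t : ℝ) = s := hS t.2 s.2
    refine FiniteMeasure.toMeasure_injective ?_
    change (Measure.dirac z₁).map _ = (Measure.dirac z₂).map _
    have hmove : Measurable fun z : projDomain Ω S Θ => (z : ℝ × ℝ).1 + t * (z : ℝ × ℝ).2 :=
      Continuous.measurable (by fun_prop)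
    rw [Measure.map_dirac' hmove, Measure.map_dirac' hmove]
    congr 1
    simp only [z₁, z₂, inner_sub_right, inner_add_right, inner_smul_right, hθθ, hts]
    ring
  have h1 : Measure.dirac z₁ = Measure.dirac z₂ := congrArg Subtype.val hδ
  have h2 : z₁ = z₂ := by
    by_contra hne
    have := congrArg (fun μ : Measure (projDomain Ω S Θ) => μ {z₁}) h1
    simp [Ne.symm hne] at this
  have := congrArg (fun z : projDomain Ω S Θ => (z : ℝ × ℝ).2) h2
  simp only [z₁, z₂, inner_add_right, hθθ] at this
  linarith

/-- The position at time `t` of a point of phase space. -/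
def phaseMove (t : S) (p : phaseDomain Ω S) : Ω :=
  ⟨p.1.1 + (t : ℝ) • p.1.2, p.2 t t.2⟩

theorem continuous_phaseMove (t : S) : Continuous (phaseMove (Ω := Ω) t) := by
  unfold phaseMove
  fun_prop

/-- Every measure on phase space induces admissible points. -/
theorem exists_admissible_of_phase (HΘ : ProbabilityMeasure Θ)
    (l : FiniteMeasure (phaseDomain Ω S)) {w : S → FiniteMeasure Ω}
    (hw : ∀ t, w t = l.map (phaseMove t)) :
    (∃ g : Θ → FiniteMeasure (projDomain Ω S Θ), ProductAdmissible (g, w)) ∧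
      ∃ γ : FiniteMeasure (Θ × projDomain Ω S Θ), MixedAdmissible HΘ (γ, w) := by
  let φ : Θ × phaseDomain Ω S → projDomain Ω S Θ := fun q =>
    ⟨(inner ℝ (q.1 : EuclideanSpace ℝ (Fin d)) q.2.1.1,
      inner ℝ (q.1 : EuclideanSpace ℝ (Fin d)) q.2.1.2), q.1, q.1.2, q.2.1, q.2.2, rfl⟩
  have hφ : Continuous φ := by fun_prop
  have hprod : ProductAdmissible (fun θ : Θ => l.map fun p => φ (θ, p), w) := by
    intro t θ
    refine FiniteMeasure.toMeasure_injective ?_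
    simp only [hw, moveAt, radonAt, FiniteMeasure.toMeasure_map]
    rw [Measure.map_map (Continuous.measurable (by fun_prop)) (Continuous.measurable (by fun_prop)),
      Measure.map_map (Continuous.measurable (by fun_prop)) (continuous_phaseMove t).measurable]
    congr 1
    ext p
    simp [φ, phaseMove, inner_add_right, inner_smul_right]
  exact ⟨⟨_, hprod⟩, _, _, (isLeftProduct_prod HΘ l).map hφ.measurable,
    fun t => .of_forall fun θ => hprod t θ⟩

/-- With at most one time every snapshot is attainable: let the particles rest at their positions.
-/
theorem exists_admissible_of_subsingleton [Subsingleton S] (t₀ : S) (HΘ : ProbabilityMeasure Θ)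
    (w : S → FiniteMeasure Ω) :
    (∃ g : Θ → FiniteMeasure (projDomain Ω S Θ), ProductAdmissible (g, w)) ∧
      ∃ γ : FiniteMeasure (Θ × projDomain Ω S Θ), MixedAdmissible HΘ (γ, w) := by
  refine exists_admissible_of_phase HΘ
    ((w t₀).map fun x => ⟨((x : EuclideanSpace ℝ (Fin d)), 0), fun t _ => by simp⟩) fun t => ?_
  rw [Subsingleton.elim t t₀]
  refine FiniteMeasure.toMeasure_injective ?_
  simp only [FiniteMeasure.toMeasure_map]
  rw [Measure.map_map (continuous_phaseMove t₀).measurable (Continuous.measurable (by fun_prop))]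
  convert Measure.map_id.symm
  ext x
  simp [phaseMove]

/-- Compatible configurations live on phase space. -/
theorem exists_phase_of_compatible (hΩ : IsClosed Ω)
    (l : FiniteMeasure (EuclideanSpace ℝ (Fin d) × EuclideanSpace ℝ (Fin d)))
    {w : S → FiniteMeasure Ω}
    (hw : ∀ t : S, (w t).map (fun x : Ω => (x : EuclideanSpace ℝ (Fin d))) =
      l.map (fun p => p.1 + (t : ℝ) • p.2)) :
    ∃ l' : FiniteMeasure (phaseDomain Ω S), ∀ t, w t = l'.map (phaseMove t) := by
  have hemb : MeasurableEmbedding (Subtype.val : phaseDomain Ω S → _) :=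
    .subtype_coe (isClosed_phaseDomain hΩ).measurableSet
  have hembΩ : MeasurableEmbedding (Subtype.val : Ω → _) := .subtype_coe hΩ.measurableSet
  have hw' : ∀ t : S, (w t : Measure Ω).map Subtype.val =
      (l : Measure (EuclideanSpace ℝ (Fin d) × EuclideanSpace ℝ (Fin d))).map
        (fun p => p.1 + (t : ℝ) • p.2) := fun t => congrArg Subtype.val (hw t)
  have hmem : ∀ t : S, ∀ᵐ p ∂(l : Measure (EuclideanSpace ℝ (Fin d) × EuclideanSpace ℝ (Fin d))),
      p.1 + (t : ℝ) • p.2 ∈ Ω := by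
    intro t
    refine ae_of_ae_map (f := fun p : EuclideanSpace ℝ (Fin d) × EuclideanSpace ℝ (Fin d) =>
      p.1 + (t : ℝ) • p.2) (p := (· ∈ Ω)) (Continuous.aemeasurable (by fun_prop)) ?_
    rw [← hw' t, hembΩ.ae_map_iff]
    exact .of_forall fun x => x.2
  have hae : ∀ᵐ p ∂(l : Measure (EuclideanSpace ℝ (Fin d) × EuclideanSpace ℝ (Fin d))),
      p ∈ phaseDomain Ω S := by
    -- For a fixed particle the times spent in the closed set `Ω` form a closed set, so staying in
    -- `Ω` at countably many dense times is enough, and this holds off a single null set.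
    obtain ⟨D, hDc, hDd⟩ := TopologicalSpace.exists_countable_dense S
    filter_upwards [(ae_ball_iff hDc).2 fun t _ => hmem t] with p hp t ht
    have hcl : IsClosed {t : S | p.1 + (t : ℝ) • p.2 ∈ Ω} := hΩ.preimage (by fun_prop)
    exact (hcl.closure_subset_iff.2 hp : closure D ⊆ _) (hDd ⟨t, ht⟩)
  refine ⟨l.comap Subtype.val, fun t => ?_⟩
  refine FiniteMeasure.toMeasure_injective (hembΩ.map_injective ?_)
  rw [hw', FiniteMeasure.toMeasure_map, FiniteMeasure.toMeasure_comap,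
    Measure.map_map measurable_subtype_coe (continuous_phaseMove t).measurable]
  change _ = Measure.map ((fun p : EuclideanSpace ℝ (Fin d) × EuclideanSpace ℝ (Fin d) =>
      p.1 + (t : ℝ) • p.2) ∘ Subtype.val) _
  rw [← Measure.map_map (Continuous.measurable (by fun_prop)) measurable_subtype_coe,
    hemb.map_comap, Subtype.range_coe, Measure.restrict_eq_self_of_ae_mem hae]

end PhaseSpace

/-- Under the compatibility assumption there is a measure on phase space with finite fidelity. -/
theorem exists_phase_fidelity_lt_top {d : ℕ} {Ω : Set (EuclideanSpace ℝ (Fin d))} {S : Set ℝ}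
    (hΩ : IsClosed Ω) {H : Type*} [NormedAddCommGroup H] {T : Finset S}
    {Ob : T → FiniteMeasure Ω → H} (f : T → H) {α : ℝ} (hα : 0 ≤ α)
    (hf : α = 0 → CompatibleData Ob f) :
    ∃ (l : FiniteMeasure (phaseDomain Ω S)) (w : S → FiniteMeasure Ω),
      (∀ t, w t = l.map (phaseMove t)) ∧ fidelity Ob f α w < ⊤ := by
  rcases hα.eq_or_lt with rfl | hα
  · obtain ⟨l, w, hlw, hw⟩ := hf rfl
    obtain ⟨l', hl'⟩ := exists_phase_of_compatible hΩ l hlw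
    exact ⟨l', w, hl', by simp [fidelity, hw]⟩
  -- For `α > 0` the fidelity is always finite, so the zero measure serves.
  · exact ⟨0, fun t => FiniteMeasure.map 0 (phaseMove t), fun _ => rfl,
      by simp [fidelity, hα.ne']⟩

/-! ### The main theorem -/

theorem mainTheorem4 {d : ℕ} {H : Type*} [NormedAddCommGroup H] [InnerProductSpace ℝ H]
    [CompleteSpace H]
    {Ω : Set (EuclideanSpace ℝ (Fin d))} {S : Set ℝ} {Θ : Set (EuclideanSpace ℝ (Fin d))}
    (hΩ : IsCompact Ω) (hS : IsCompact S) (hΘ : IsCompact Θ)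
    (hΘ_sphere : Θ ⊆ Metric.sphere 0 1)
    (HS : ProbabilityMeasure S) (HΘ : ProbabilityMeasure Θ)
    (hΘ_supp : (HΘ : Measure Θ).support = Set.univ)
    (θ₀ : Θ) (T : Finset S)
    (Ob : T → FiniteMeasure Ω → H) (hOb : ∀ t, IsObservationOperator (Ob t))
    (f : T → H) (α : ℝ) (hα : 0 ≤ α) (hf : α = 0 → CompatibleData Ob f) :
    -- the snapshots are uniquely defined at every time in the measure/measure model
    ((HS : Measure S).support = Set.univ → RadonInjective Ω HΘ →
      ∀ (γ : FiniteMeasure (Θ × projDomain Ω S Θ)) (u : FiniteMeasure (Ω × S)),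
        MeasureAdmissible HS HΘ (γ, u) → ∃! v : S → FiniteMeasure Ω, IsTimeSlices HS HΘ u v) ∧
    -- existence of minimizers
    (∃ p : (Θ → FiniteMeasure (projDomain Ω S Θ)) × (S → FiniteMeasure Ω),
      IsSolution ProductAdmissible (productEnergy θ₀ Ob f α) p) ∧
    (∃ p : FiniteMeasure (Θ × projDomain Ω S Θ) × (S → FiniteMeasure Ω),
      IsSolution (MixedAdmissible HΘ) (mixedEnergy Ob f α) p) ∧
    ((HS : Measure S).support = Set.univ → RadonInjective Ω HΘ →
      ∃ p : FiniteMeasure (Θ × projDomain Ω S Θ) × FiniteMeasure (Ω × S),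
        IsSolution (MeasureAdmissible HS HΘ) (measureEnergy HS HΘ Ob f α) p) ∧
    -- equivalence of the product/product and the mixed model
    (MoveInjective (projDomain Ω S Θ) HS →
      (∀ (γ : FiniteMeasure (Θ × projDomain Ω S Θ)) (u : S → FiniteMeasure Ω),
        IsSolution (MixedAdmissible HΘ) (mixedEnergy Ob f α) (γ, u) →
        ∃! g : Θ → FiniteMeasure (projDomain Ω S Θ), ProjectionsCoincide HS HΘ γ g ∧
          IsSolution ProductAdmissible (productEnergy θ₀ Ob f α) (g, u) ∧
          productEnergy θ₀ Ob f α (g, u) = mixedEnergy Ob f α (γ, u)) ∧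
      (∀ (g : Θ → FiniteMeasure (projDomain Ω S Θ)) (u : S → FiniteMeasure Ω),
        IsSolution ProductAdmissible (productEnergy θ₀ Ob f α) (g, u) →
        ∃! γ : FiniteMeasure (Θ × projDomain Ω S Θ), ProjectionsCoincide HS HΘ γ g ∧
          IsSolution (MixedAdmissible HΘ) (mixedEnergy Ob f α) (γ, u) ∧
          mixedEnergy Ob f α (γ, u) = productEnergy θ₀ Ob f α (g, u))) ∧
    -- equivalence of the mixed and the measure/measure model
    ((HS : Measure S).support = Set.univ → RadonInjective Ω HΘ →
      (∀ (γ : FiniteMeasure (Θ × projDomain Ω S Θ)) (v : S → FiniteMeasure Ω),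
        IsSolution (MixedAdmissible HΘ) (mixedEnergy Ob f α) (γ, v) →
        ∃! u : FiniteMeasure (Ω × S), SnapshotsCoincide HS HΘ u v ∧
          IsSolution (MeasureAdmissible HS HΘ) (measureEnergy HS HΘ Ob f α) (γ, u) ∧
          measureEnergy HS HΘ Ob f α (γ, u) = mixedEnergy Ob f α (γ, v)) ∧
      (∀ (γ : FiniteMeasure (Θ × projDomain Ω S Θ)) (u : FiniteMeasure (Ω × S)),
        IsSolution (MeasureAdmissible HS HΘ) (measureEnergy HS HΘ Ob f α) (γ, u) →
        ∃! v : S → FiniteMeasure Ω, SnapshotsCoincide HS HΘ u v ∧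
          IsSolution (MixedAdmissible HΘ) (mixedEnergy Ob f α) (γ, v) ∧
          mixedEnergy Ob f α (γ, v) = measureEnergy HS HΘ Ob f α (γ, u))) := by
  have hΩc : CompactSpace Ω := isCompact_iff_compactSpace.1 hΩ
  have hΘc : CompactSpace Θ := isCompact_iff_compactSpace.1 hΘ
  obtain ⟨t₀⟩ := HS.nonempty
  have hD := lowerSemicontinuous_fidelity hOb f hα
  obtain ⟨l, w, hlw, hfin⟩ := exists_phase_fidelity_lt_top hΩ.isClosed f hα hf
  obtain ⟨⟨g₀, hg₀⟩, γ₀, hγ₀⟩ := exists_admissible_of_phase HΘ l hlw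
  have hexists : (∃ p : (Θ → FiniteMeasure (projDomain Ω S Θ)) × (S → FiniteMeasure Ω),
        IsSolution ProductAdmissible (productEnergy θ₀ Ob f α) p) ∧
      ∃ p : FiniteMeasure (Θ × projDomain Ω S Θ) × (S → FiniteMeasure Ω),
        IsSolution (MixedAdmissible HΘ) (mixedEnergy Ob f α) p := by
    -- With a single time the velocities in the projected domain need not be bounded, so the direct
    -- method is run on the snapshot alone. Any admissible `g` or `γ` over a snapshot has the mass
    -- of that snapshot, so the minimum carries over.
    rcases S.subsingleton_or_nontrivial with hSs | hSn
    · have : Subsingleton S := Set.subsingleton_coe S |>.2 hSs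
      obtain ⟨v, hv⟩ := exists_snapshots_isSolution t₀ hD hfin
      obtain ⟨⟨g, hg⟩, γ, hγ⟩ := exists_admissible_of_subsingleton t₀ HΘ v
      refine ⟨⟨(g, v), hv.transfer (fun y hy => ⟨y.2, trivial, ?_⟩) hg ?_⟩,
        ⟨(γ, v), hv.transfer (fun y hy => ⟨y.2, trivial, ?_⟩) hγ ?_⟩⟩
      · simp only [productEnergy, ← hy.mass_eq t₀ θ₀]
      · simp only [productEnergy, ← hg.mass_eq t₀ θ₀]
      · simp only [mixedEnergy, ← hy.mass_eq t₀]
      · simp only [mixedEnergy, ← hγ.mass_eq t₀]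
    · have : CompactSpace (projDomain Ω S Θ) :=
        isCompact_iff_compactSpace.1 (isCompact_projDomain hΩ hΘ hSn)
      exact ⟨exists_productAdmissible_isSolution t₀ θ₀ hD hg₀ hfin,
        exists_mixedAdmissible_isSolution HΘ t₀ hD hγ₀ hfin⟩
  refine ⟨fun hSsupp hR γ u hadm => ?_, hexists.1, hexists.2, fun hSsupp hR => ?_, fun hM => ?_,
    fun hSsupp hR => ⟨fun γ v h => ?_, fun γ u h => ?_⟩⟩
  · obtain ⟨v, hv, -⟩ := hadm.exists_isTimeSlices hSsupp hR
    exact ⟨v, hv, fun v' hv' => hv'.unique hSsupp hR hv⟩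
  · obtain ⟨p, hp⟩ := hexists.2
    obtain ⟨u, -, hu⟩ := IsSolution.measure_of_mixed (HS := HS) hSsupp hR hp
    exact ⟨_, hu⟩
  · have hGc : CompactSpace (projDomain Ω S Θ) := by
      refine isCompact_iff_compactSpace.1 ?_
      -- Injectivity of the move operator excludes the noncompact case: with one time it forces the
      -- projected domain to be empty.
      rcases S.subsingleton_or_nontrivial with hSs | hSn
      · rw [hM.projDomain_eq_empty hΘ_sphere hSs]
        exact isCompact_empty
      · exact isCompact_projDomain hΩ hΘ hSn
    refine ⟨fun γ u h => ?_, fun g u h => ?_⟩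
    · obtain ⟨g, hg, hsol⟩ := IsSolution.product_of_mixed (θ₀ := θ₀) hΘ_supp hM h
      exact ⟨g, ⟨⟨hg, fun g' hg' => hg'.unique hΘ_supp hM hg⟩, hsol,
        productEnergy_eq_mixedEnergy t₀ hsol.1 h.1⟩, fun g' hg' => hg'.1.1.unique hΘ_supp hM hg⟩
    · obtain ⟨γ, hγ, hsol⟩ := IsSolution.mixed_of_product hΘ_supp hM h
      -- Uniqueness of `γ` needs no injectivity, since a family of slices determines its product;
      -- injectivity enters only through the uniqueness of the slices.
      exact ⟨γ, ⟨⟨hγ, fun g' hg' => hg'.unique hΘ_supp hM hγ⟩, hsol,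
        (productEnergy_eq_mixedEnergy t₀ h.1 hsol.1).symm⟩, fun γ' hγ' => hγ'.1.1.1.unique hγ.1⟩
  · obtain ⟨u, hu, hsol⟩ := IsSolution.measure_of_mixed (HS := HS) hSsupp hR h
    exact ⟨u, ⟨⟨hu, fun v' hv' => hv'.unique hSsupp hR hu⟩, hsol,
      measureEnergy_eq_mixedEnergy hSsupp hR Ob f α γ hu⟩, fun u' hu' => hu'.1.1.1.unique hu.1⟩
  · obtain ⟨v, hv, hsol⟩ := IsSolution.mixed_of_measure hSsupp hR h
    exact ⟨v, ⟨⟨hv, fun v' hv' => hv'.unique hSsupp hR hv⟩, hsol,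
      (measureEnergy_eq_mixedEnergy hSsupp hR Ob f α γ hv).symm⟩,
      fun v' hv' => hv'.1.1.unique hSsupp hR hv⟩
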